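/- Let $r\ge 2$, let $\mathbb F=\langle a_1,\dots,a_r\rangle$ be the free group of rank $r$, let $S=\{a_i^{\pm1}\}$, and let $|g|$ denote the length of the reduced word of $g\in\mathbb F$. Let $\partial\mathbb F$ be the set of sequences $\xi=(\xi_1,\xi_2,\dots)\in S^{\mathbb N}$ with $\xi_{i+1}\neq\xi_i^{-1}$ for all $i\ge1$, with its Borel $\sigma$-algebra and the Borel probability measure $\nu$ determined by $$\nu(\{\xi:\ \xi_i=s_i\ \forall\,1\le i\le n\})=(2r)^{-1}(2r-1)^{-(n-1)}$$ for all $n\ge 1$ and all $s_1,\dots,s_n\in S$ with $s_{i+1}\ne s_i^{-1}$. The group $\mathbb F$ acts on $\partial\mathbb F$ by $$(t_1\cdots t_n)\xi=(t_1,\dots,t_{n-k},\xi_{k+1},\xi_{k+2},\dots),$$ where $t_1\cdots t_n$ is in reduced form and $k\le n$ is the largest number such that $\xi_i^{-1}=t_{n+1-i}$ for all $i\le k$. For $\xi\in\partial\mathbb F$ let $$H_\xi=\{g\in\mathbb F:\ \text{there is } N \text{ with } (g^{-1}\xi)_i=\xi_i \text{ for all } i>N\}$$ be the horosphere centered at $\xi$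 through the identity. Let $\mathbb F$ act on a standard Borel space $X$ with a $\sigma$-finite measure $\lambda$ by non-singular (measurable, measure-class preserving) transformations, put $\eta=\lambda\times\nu$, and let $\mathbb F$ act diagonally on $X\times\partial\mathbb F$. For $g\in\mathbb F$ and $f\in L^1(X\times\partial\mathbb F,\eta)$ put $$\widehat T^g f(z)=f(g^{-1}z)\,\frac{d(g_*\eta)}{d\eta}(z),\qquad g_*\eta(E)=\eta(g^{-1}E).$$ Let $\mathcal R_0(X)$ be the equivalence relation on $X\times\partial\mathbb F$ under which $(x,\xi)$ is equivalent to $(y,\xi')$ if and only if $(y,\xi')=(g^{-1}x,g^{-1}\xi)$ for some $g\in H_\xi$. It is called ergodic if every measurable union of $\mathcal R_0(X)$-classes is $\eta$-null or has $\eta$-null complement. **Theorem.** Let $u,v\in L^1(X\times\partial\mathbb F,\eta)$ be real-valued with $v>0$ almost everywhere. Then the ratios $$\frac{\sum_{g\in H_\xi,\ |g|\le 2n}\widehat T^g u(x,\xi)}{\sum_{g\in H_\xi,\ |g|\le 2n}\widehat T^g v(x,\xi)}$$ converge, as $n\to\infty$, for $\eta$-almost every $(x,\xi)$ to a measurable $\mathcal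 R_0(X)$-invariant function $r(u,v):X\times\partial\mathbb F\to\mathbb R$. If $\mathcal R_0(X)$ is ergodic, then $r(u,v)=\dfrac{\int u\,d\eta}{\int v\,d\eta}$ almost everywhere. -/

import Mathlib

open MeasureTheory Filter Topology

namespace HoroRatio

/-- The symmetric generating set `S = {a_i, a_i⁻¹}`: `(i, true)` is `a_i` and `(i, false)` is
`a_i⁻¹`, as in `FreeGroup.mk`. -/
abbrev Letter (r : ℕ) : Type := Fin r × Bool

/-- The free group `F = ⟨a_1, …, a_r⟩`; the reduced word of `g` is `FreeGroup.toWord g` and its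
length `|g|` is `FreeGroup.norm g`. -/
abbrev F (r : ℕ) : Type := FreeGroup (Fin r)

/-- The inverse of a letter. -/
def Letter.inv {r : ℕ} (s : Letter r) : Letter r := (s.1, !s.2)

theorem Letter.inv_inv {r : ℕ} (s : Letter r) : Letter.inv (Letter.inv s) = s := by
  simp [Letter.inv]

/-- The boundary `∂F`: infinite reduced words. The letter `ξ_{i+1}` is `ξ.1 i`. -/
def Boundary (r : ℕ) : Type :=
  {ξ : ℕ → Letter r // ∀ i, ξ (i + 1) ≠ Letter.inv (ξ i)}

/-- The Borel σ-algebra of `∂F ⊆ S^ℕ`. -/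
instance (r : ℕ) : MeasurableSpace (Boundary r) :=
  inferInstanceAs (MeasurableSpace {ξ : ℕ → Letter r // ∀ i, ξ (i + 1) ≠ Letter.inv (ξ i)})

/-! ### The action of the free group on its boundary -/

theorem Boundary.ext {r : ℕ} {ξ η : Boundary r} (h : ∀ i, ξ.1 i = η.1 i) : ξ = η :=
  Subtype.ext (funext h)

/-- Delete the first letter. -/
def shift {r : ℕ} (ξ : Boundary r) : Boundary r :=
  ⟨fun i => ξ.1 (i + 1), fun i => ξ.2 (i + 1)⟩

/-- Prefix a letter that does not cancel. -/
def cons {r : ℕ} (s : Letter r) (ξ : Boundary r) (h : ξ.1 0 ≠ Letter.inv s) : Boundary r :=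
  ⟨fun i => Nat.casesOn i s ξ.1, fun i => by
    cases i with
    | zero => exact h
    | succ j => exact ξ.2 j⟩

/-- Multiplication of an infinite reduced word by one letter, on the left, with cancellation. -/
def letterAct {r : ℕ} (s : Letter r) (ξ : Boundary r) : Boundary r :=
  if h : ξ.1 0 = Letter.inv s then shift ξ else cons s ξ h

theorem letterAct_inv {r : ℕ} (s : Letter r) (ξ : Boundary r) :
    letterAct (Letter.inv s) (letterAct s ξ) = ξ := by
  by_cases h : ξ.1 0 = Letter.inv s
  · have h1 : letterAct s ξ = shift ξ := dif_pos h
    have h2 : ¬ (shift ξ).1 0 = Letter.inv (Letter.inv s) := by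
      rw [← h]; exact ξ.2 0
    rw [h1, letterAct, dif_neg h2]
    apply Boundary.ext
    intro i
    cases i with
    | zero => exact h.symm
    | succ j => rfl
  · have h1 : letterAct s ξ = cons s ξ h := dif_neg h
    have h2 : (cons s ξ h).1 0 = Letter.inv (Letter.inv s) := (Letter.inv_inv s).symm
    rw [h1, letterAct, dif_pos h2]
    exact Boundary.ext fun _ => rfl

/-- The generator `a_i` as a permutation of the boundary. -/
def genPerm {r : ℕ} (i : Fin r) : Equiv.Perm (Boundary r) where
  toFun := letterAct (i, true)
  invFun := letterAct (i, false)
  left_inv ξ := letterAct_inv (i, true) ξ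
  right_inv ξ := letterAct_inv (i, false) ξ

/-- The action of the free group on its boundary. See `smul_eq_append` for its formula. -/
instance boundaryAction (r : ℕ) : MulAction (F r) (Boundary r) :=
  MulAction.compHom (Boundary r) (FreeGroup.lift (genPerm (r := r)))

theorem mk_cons_smul {r : ℕ} (s : Letter r) (w : List (Letter r)) (ξ : Boundary r) :
    (FreeGroup.mk (s :: w) : F r) • ξ = letterAct s ((FreeGroup.mk w : F r) • ξ) := by
  have h : (FreeGroup.mk (s :: w) : F r) = FreeGroup.mk [s] * FreeGroup.mk w := by
    simp
  rw [h, mul_smul]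
  generalize (FreeGroup.mk w : F r) • ξ = η
  obtain ⟨i, b⟩ := s
  change FreeGroup.lift (genPerm (r := r)) (FreeGroup.mk [(i, b)]) η = _
  cases b
  · simp [FreeGroup.lift_mk]; rfl
  · simp [FreeGroup.lift_mk]; rfl

/-- The boundary action in terms of reduced words: if the reduced word of `g` is
`t_1 ⋯ t_{n-k} ξ_k⁻¹ ⋯ ξ_1⁻¹` and `k` is the largest possible (either `k = n`, or `t_{n-k}` does
not cancel with `ξ_{k+1}`), then `g ξ = (t_1, …, t_{n-k}, ξ_{k+1}, ξ_{k+2}, …)`. -/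
theorem smul_eq_append {r : ℕ} (g : F r) (ξ : Boundary r) (k : ℕ) (t : List (Letter r))
    (hg : g.toWord = t ++ ((List.range k).map fun i => Letter.inv (ξ.1 i)).reverse)
    (hk : ∀ s ∈ t.getLast?, ξ.1 k ≠ Letter.inv s) (i : ℕ) :
    (g • ξ).1 i = if h : i < t.length then t[i] else ξ.1 (i - t.length + k) := by
  have key : ∀ k, ∀ j, ((FreeGroup.mk
      ((List.range k).map fun i => Letter.inv (ξ.1 i)).reverse : F r) • ξ).1 j = ξ.1 (j + k) := by
    intro k
    induction k with
    | zero => intro j; simp [← FreeGroup.one_eq_mk]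
    | succ k ih =>
      intro j
      rw [List.range_succ, List.map_append, List.reverse_append, List.map_singleton,
        List.reverse_singleton, List.singleton_append, mk_cons_smul]
      have h0 := ih 0
      rw [letterAct, dif_pos (by rw [h0, Letter.inv_inv, Nat.zero_add])]
      change (_ : Boundary r).1 (j + 1) = _
      rw [ih, Nat.add_right_comm, Nat.add_assoc]
  have hred : FreeGroup.IsReduced t := by
    have := FreeGroup.isReduced_toWord (x := g)
    rw [hg] at this
    exact (List.isChain_append.1 this).1
  rw [← FreeGroup.mk_toWord (x := g), hg, ← FreeGroup.mul_mk, mul_smul]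
  have h0 := key k
  generalize (FreeGroup.mk
      ((List.range k).map fun i => Letter.inv (ξ.1 i)).reverse : F r) • ξ = η at h0
  clear hg key
  have hk' : ∀ s ∈ t.getLast?, η.1 0 ≠ Letter.inv s := by
    intro s hs; rw [h0, Nat.zero_add]; exact hk s hs
  simp only [← h0]
  clear hk h0
  induction t generalizing i with
  | nil => simp [← FreeGroup.one_eq_mk]
  | cons s w ih =>
    rw [mk_cons_smul]
    have hw : ∀ a ∈ w.getLast?, η.1 0 ≠ Letter.inv a := by
      intro a ha
      apply hk'
      cases w with
      | nil => simp at ha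
      | cons b l => rw [List.getLast?_cons_cons]; exact ha
    have ihw := fun j => ih j (List.isChain_of_isChain_cons hred) hw
    have hne : ((FreeGroup.mk w : F r) • η).1 0 ≠ Letter.inv s := by
      rw [ihw]
      cases w with
      | nil => simpa using hk' s (by simp)
      | cons b l =>
        have hsb := (List.isChain_cons_cons.1 hred).1
        intro hb
        have hb' : b = Letter.inv s := by simpa using hb
        have := hsb (by rw [hb']; rfl)
        rw [hb'] at this
        simp [Letter.inv] at this
    rw [letterAct, dif_neg hne]
    cases i with
    | zero => simp [cons]
    | succ j =>
      change ((FreeGroup.mk w : F r) • η).1 j = _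
      rw [ihw]
      simp

theorem measurable_letterAct {r : ℕ} (s : Letter r) : Measurable (letterAct s) := by
  have hc : ∀ i, Measurable fun ξ : Boundary r => ξ.1 i := fun i =>
    (measurable_pi_apply i).comp measurable_subtype_coe
  have hA : MeasurableSet {ξ : Boundary r | ξ.1 0 = Letter.inv s} :=
    hc 0 (measurableSet_singleton _)
  apply Measurable.subtype_mk (f := fun ξ => (letterAct s ξ).1)
  rw [measurable_pi_iff]
  intro i
  have h : (fun ξ : Boundary r => (letterAct s ξ).1 i) = fun ξ =>
      if ξ.1 0 = Letter.inv s then ξ.1 (i + 1) else Nat.casesOn i s ξ.1 := by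
    funext ξ
    by_cases h : ξ.1 0 = Letter.inv s
    · simp only [letterAct, dif_pos h, if_pos h]; rfl
    · simp only [letterAct, dif_neg h, if_neg h]; rfl
  rw [h]
  refine Measurable.ite hA (hc _) ?_
  cases i with
  | zero => exact measurable_const
  | succ j => exact hc j

/-- The boundary action is by measurable maps. -/
theorem measurable_boundary_smul {r : ℕ} (g : F r) : Measurable fun ξ : Boundary r => g • ξ := by
  rw [← FreeGroup.mk_toWord (x := g)]
  generalize g.toWord = w
  induction w with
  | nil =>
    simp only [← FreeGroup.one_eq_mk, one_smul]
    exact measurable_id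
  | cons s w ih =>
    simp only [mk_cons_smul]
    exact (measurable_letterAct s).comp ih

/-! ### The Markov measure on the boundary -/

/-- An enumeration of the `2r - 1` letters that may follow the letter `s` in a reduced word. -/
noncomputable def nextEquiv {r : ℕ} (s : Letter r) :
    Fin (2 * r - 1) ≃ {t : Letter r // t ≠ Letter.inv s} :=
  (Fintype.equivFinOfCardEq (by
    rw [Fintype.card_subtype_compl]; simp [mul_comm])).symm

/-- The infinite reduced word with first letter `p.1`, whose later letters are chosen among the
`2r - 1` admissible ones by the sequence `p.2`. -/
noncomputable def pathLetter {r : ℕ} (p : Letter r × (ℕ → Fin (2 * r - 1))) : ℕ → Letter r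
  | 0 => p.1
  | n + 1 => (nextEquiv (pathLetter p n) (p.2 n)).1

/-- `pathLetter` as a point of the boundary. -/
noncomputable def path {r : ℕ} (p : Letter r × (ℕ → Fin (2 * r - 1))) : Boundary r :=
  ⟨pathLetter p, fun i => (nextEquiv (pathLetter p i) (p.2 i)).2⟩

/-- The Markov measure `ν` on `∂F`: the first letter is uniform in the `2r` letters, and each later
letter is uniform among the `2r - 1` letters that do not cancel with the previous one. It is
characterised by its values on cylinders, see `boundaryMeasure_cylinder`. -/
noncomputable def boundaryMeasure {r : ℕ} (hr : 2 ≤ r) : Measure (Boundary r) :=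
  haveI : Nonempty (Letter r) := ⟨(⟨0, by omega⟩, true)⟩
  haveI : Nonempty (Fin (2 * r - 1)) := ⟨⟨0, by omega⟩⟩
  ((PMF.uniformOfFintype (Letter r)).toMeasure.prod
    (Measure.infinitePi fun _ : ℕ => (PMF.uniformOfFintype (Fin (2 * r - 1))).toMeasure)).map path

theorem measurable_path {r : ℕ} : Measurable (path (r := r)) := by
  have key : ∀ n, Measurable fun p : Letter r × (ℕ → Fin (2 * r - 1)) => pathLetter p n := by
    intro n
    induction n with
    | zero => exact measurable_fst
    | succ n ih =>
      have h2 : Measurable fun p : Letter r × (ℕ → Fin (2 * r - 1)) => p.2 n :=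
        (measurable_pi_apply n).comp measurable_snd
      generalize hf : (fun p : Letter r × (ℕ → Fin (2 * r - 1)) => pathLetter p n) = f at ih
      have h3 : (fun p : Letter r × (ℕ → Fin (2 * r - 1)) => pathLetter p (n + 1)) =
          (fun q : Letter r × Fin (2 * r - 1) => (nextEquiv q.1 q.2).1) ∘
            fun p => (f p, p.2 n) := by
        rw [← hf]; rfl
      rw [h3]
      exact (Measurable.of_discrete).comp (ih.prodMk h2)
  exact Measurable.subtype_mk (measurable_pi_iff.2 key)

instance isProbabilityMeasure_boundaryMeasure {r : ℕ} (hr : 2 ≤ r) :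
    IsProbabilityMeasure (boundaryMeasure hr) := by
  have : Nonempty (Letter r) := ⟨(⟨0, by omega⟩, true)⟩
  have : Nonempty (Fin (2 * r - 1)) := ⟨⟨0, by omega⟩⟩
  exact Measure.isProbabilityMeasure_map measurable_path.aemeasurable

/-- `ν {ξ | ξ_i = t_i for 1 ≤ i ≤ n} = (2r)⁻¹ (2r-1)^{-(n-1)}` for every reduced word
`t_1 ⋯ t_n`, here with `n = m + 1`. -/
theorem boundaryMeasure_cylinder {r : ℕ} (hr : 2 ≤ r) (m : ℕ) (t : ℕ → Letter r)
    (ht : ∀ i < m, t (i + 1) ≠ Letter.inv (t i)) :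
    boundaryMeasure hr {ξ : Boundary r | ∀ i ≤ m, ξ.1 i = t i} =
      (2 * r : ENNReal)⁻¹ * ((2 * r - 1 : ℕ) : ENNReal)⁻¹ ^ m := by
  have : Nonempty (Letter r) := ⟨(⟨0, by omega⟩, true)⟩
  have : Nonempty (Fin (2 * r - 1)) := ⟨⟨0, by omega⟩⟩
  have hms : MeasurableSet {ξ : Boundary r | ∀ i ≤ m, ξ.1 i = t i} := by
    have : {ξ : Boundary r | ∀ i ≤ m, ξ.1 i = t i} =
        ⋂ i, ⋂ (_ : i ≤ m), (fun ξ : Boundary r => ξ.1 i) ⁻¹' {t i} := by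
      ext ξ; simp
    rw [this]
    exact MeasurableSet.iInter fun i => MeasurableSet.iInter fun _ =>
      ((measurable_pi_apply i).comp measurable_subtype_coe) (measurableSet_singleton _)
  let j : ℕ → Fin (2 * r - 1) := fun i =>
    if h : t (i + 1) ≠ Letter.inv (t i) then (nextEquiv (t i)).symm ⟨_, h⟩
    else Classical.arbitrary _
  have hj : ∀ i < m, ∀ a, (nextEquiv (t i) a).1 = t (i + 1) ↔ a = j i := by
    intro i hi a
    simp only [j, dif_pos (ht i hi)]
    rw [Equiv.eq_symm_apply, Subtype.ext_iff]
  have hpre : path ⁻¹' {ξ : Boundary r | ∀ i ≤ m, ξ.1 i = t i} =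
      {t 0} ×ˢ (Set.pi (Finset.range m : Set ℕ) fun i => {j i}) := by
    ext ⟨s, ω⟩
    simp only [Set.mem_preimage, Set.mem_ofPred_eq, Set.mem_prod, Set.mem_singleton_iff,
      Set.mem_pi, Finset.coe_range, Set.mem_Iio]
    change (∀ i ≤ m, pathLetter (s, ω) i = t i) ↔ _
    constructor
    · intro h
      refine ⟨h 0 (Nat.zero_le _), fun i hi => ?_⟩
      rw [← hj i hi, ← h i hi.le, ← h (i + 1) hi]
      rfl
    · rintro ⟨h0, h⟩ i
      induction i with
      | zero => exact fun _ => h0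
      | succ i ih =>
        intro hi
        change (nextEquiv (pathLetter (s, ω) i) (ω i)).1 = _
        rw [ih (by omega), hj i (by omega)]
        exact h i (by omega)
  rw [boundaryMeasure, Measure.map_apply measurable_path hms, hpre, Measure.prod_prod,
    Measure.infinitePi_pi _ (fun i _ => measurableSet_singleton _)]
  simp [mul_comm]

/-! ### Horospheres and the horospherical relation -/

/-- The tail relation `R₀` on `∂F`. -/
def TailRel {r : ℕ} (ξ η : Boundary r) : Prop :=
  ∃ N, ∀ n ≥ N, ξ.1 n = η.1 n

/-- The horosphere `H_ξ` through the identity, centred at `ξ`. -/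
def horosphere {r : ℕ} (ξ : Boundary r) : Set (F r) :=
  {g | TailRel ξ (g⁻¹ • ξ)}

/-- The relation `R₀(X)` on `X × ∂F`. -/
def HoroRel {r : ℕ} (X : Type*) [MulAction (F r) X] (z z' : X × Boundary r) : Prop :=
  ∃ g ∈ horosphere z.2, z' = g⁻¹ • z

/-- A function that is constant on the classes of a relation. -/
def RelInvariant {B C : Type*} (R : B → B → Prop) (f : B → C) : Prop :=
  ∀ b b', R b b' → f b = f b'

/-- Ergodicity of a relation: measurable saturated sets are null or conull. -/
def RelErgodic {B : Type*} [MeasurableSpace B] (R : B → B → Prop) (μ : Measure B) : Prop :=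
  ∀ A : Set B, MeasurableSet A → (∀ b b', R b b' → (b ∈ A ↔ b' ∈ A)) → μ A = 0 ∨ μ Aᶜ = 0

/-- The intersection of the horosphere `H_ξ` with the ball of radius `2n` in `F`. -/
def horoBall {r : ℕ} (ξ : Boundary r) (n : ℕ) : Set (F r) :=
  {g | g ∈ horosphere ξ ∧ g.norm ≤ 2 * n}

theorem horoBall_finite {r : ℕ} (ξ : Boundary r) (n : ℕ) : (horoBall ξ n).Finite := by
  refine Set.Finite.of_finite_image (f := FreeGroup.toWord) ?_ FreeGroup.toWord_injective.injOn
  refine (List.finite_length_le (Letter r) (2 * n)).subset ?_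
  rintro _ ⟨g, hg, rfl⟩
  exact hg.2

/-! ### The ratios -/

/-- The operator `T̂^g f = (f ∘ g⁻¹) · d(g_* η)/dη` induced on `L¹(Z, η)` by an action on `Z`. -/
noncomputable def That {G Z : Type*} [Group G] [MulAction G Z] [MeasurableSpace Z]
    (η : Measure Z) (g : G) (f : Z → ℝ) (z : Z) : ℝ :=
  f (g⁻¹ • z) * ((η.map fun y => g • y).rnDeriv η z).toReal

/-- The sum of `T̂^g f (z)` over the elements `g` of `H_ξ` with `|g| ≤ 2n`, for `z = (x, ξ)`. -/
noncomputable def horoSum {r : ℕ} {X : Type*} [MulAction (F r) X] [MeasurableSpace X]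
    (η : Measure (X × Boundary r)) (n : ℕ) (f : X × Boundary r → ℝ) (z : X × Boundary r) : ℝ :=
  ∑ g ∈ (horoBall_finite z.2 n).toFinset, That η g f z

end HoroRatio

/-!
The sums in the statement run over finite equivalence classes. For a boundary point `ξ` that is not
eventually periodic, `g` lies in `H_ξ` and has length at most `2n` exactly when `g⁻¹ • ξ` agrees
with `ξ` from the `n`-th letter on (`mem_horoBall_iff`). Since the eventually periodic points are
countable and the Markov measure has no atoms, on a conull invariant set the relation `R₀(X)` is the
increasing union of the finite relations whose classes are `{g⁻¹ • z | g ∈ H_ξ, |g| ≤ 2n}`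
(`exists_isExhaustion_horoBall`). The action on the boundary is non-singular because multiplication
by a letter changes the Markov measure by the factors `(2r - 1)^{±1}`
(`map_letterAct_boundaryMeasure`).

For any increasing sequence of finite subrelations of the orbit relation of a non-singular action
there is a ratio ergodic theorem, proved as follows. Write `S_n f` for the sum of `T̂^g f` over the
`n`-th class. By the cocycle identity, the values of `S_n f` at two points of one class differ by a
factor that does not depend on `f`. So `S_n u / S_n v` is constant on the classes, and mass transport
gives `∫_A f = ∫_A (v / S_n v) S_n f` on every set `A` saturated for the `n`-th relation
(`IsExhaustion.setIntegral_eq`). Splitting a set according to the last `k ≤ N` with `S_k f ≥ 0` gives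
a maximal inequality: if `A` is saturated for all the relations and at each of its points some
`S_n f` is nonnegative, then `∫_A f ≥ 0` (`IsExhaustion.setIntegral_nonneg`).

The maximal inequality holds on every saturated set, so it can be applied to `u - b v` and `a v - u`
on the set where the ratios are infinitely often `< a` and infinitely often `> b`. For `a < b` this
set is therefore null; likewise the set where the ratios are unbounded is null, and hence the ratios
converge. If the relation is ergodic, each set `{ρ > c}` or `{ρ < c}` defined by the limit `ρ` is
null or conull, and the same inequality on the conull ones compares `c` with `∫ u / ∫ v`.
-/

namespace HoroRatio

/-! ### The Radon–Nikodym cocycle of a non-singular action -/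

section Cocycle

variable {G Z : Type*} [Group G] [MulAction G Z] [MeasurableSpace Z]

/-- The Radon–Nikodym cocycle `d(g_* η)/dη`, as a real-valued function. -/
noncomputable def rnCocycle (η : Measure Z) (g : G) (z : Z) : ℝ :=
  ((η.map fun y => g • y).rnDeriv η z).toReal

theorem rnCocycle_nonneg (η : Measure Z) (g : G) (z : Z) : 0 ≤ rnCocycle η g z :=
  ENNReal.toReal_nonneg

theorem measurable_rnCocycle (η : Measure Z) (g : G) : Measurable (rnCocycle η g) :=
  (Measure.measurable_rnDeriv _ _).ennreal_toReal

theorem rnCocycle_one (η : Measure Z) [SigmaFinite η] :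
    ∀ᵐ z ∂η, rnCocycle η (1 : G) z = 1 := by
  have h : (η.map fun y => (1 : G) • y) = η := by
    simp
  filter_upwards [Measure.rnDeriv_self η] with z hz
  rw [rnCocycle, h, hz, ENNReal.toReal_one]

variable [MeasurableConstSMul G Z]

instance sigmaFinite_map_smul (η : Measure Z) [SigmaFinite η] (g : G) :
    SigmaFinite (η.map fun y => g • y) :=
  (MeasurableEquiv.smul g : Z ≃ᵐ Z).sigmaFinite_map

theorem rnCocycle_mul {η : Measure Z} [SigmaFinite η]
    (hq : ∀ g : G, Measure.QuasiMeasurePreserving (fun z : Z => g • z) η η) (g h : G) :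
    ∀ᵐ z ∂η, rnCocycle η (g * h) z = rnCocycle η g z * rnCocycle η h (g⁻¹ • z) := by
  have hmap : (η.map fun y => (g * h) • y) = (η.map fun y => h • y).map fun y => g • y := by
    rw [Measure.map_map (measurable_const_smul g) (measurable_const_smul h)]
    simp only [Function.comp_def, mul_smul]
  have hac : ((η.map fun y => h • y).map fun y => g • y) ≪ η.map fun y => g • y :=
    (hq h).absolutelyContinuous.map (measurable_const_smul g)
  have : SigmaFinite ((η.map fun y => h • y).map fun y => g • y) := sigmaFinite_map_smul _ g
  have h1 := (MeasurableEquiv.smul g : Z ≃ᵐ Z).measurableEmbedding.rnDeriv_map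
    (η.map fun y => h • y) η
  have h2 := (hq g⁻¹).ae h1
  have h3 := Measure.rnDeriv_mul_rnDeriv (κ := η) hac
  filter_upwards [h2, h3] with z hz2 hz3
  have hz2' : ((η.map fun y => h • y).map fun y => g • y).rnDeriv (η.map fun y => g • y) z =
      (η.map fun y => h • y).rnDeriv η (g⁻¹ • z) := by
    rw [← hz2]
    change _ = (Measure.map _ _).rnDeriv (Measure.map _ _) (g • g⁻¹ • z)
    rw [smul_inv_smul]
    rfl
  rw [rnCocycle, rnCocycle, rnCocycle, hmap, ← hz3, Pi.mul_apply, hz2', ENNReal.toReal_mul,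
    mul_comm]

theorem integral_rnCocycle_mul {η : Measure Z} [SigmaFinite η]
    (hq : ∀ g : G, Measure.QuasiMeasurePreserving (fun z : Z => g • z) η η) (g : G) (f : Z → ℝ) :
    ∫ z, rnCocycle η g z * f z ∂η = ∫ z, f (g • z) ∂η := by
  have h := integral_rnDeriv_smul (hq g).absolutelyContinuous (f := f)
  exact h.trans (integral_map_equiv (MeasurableEquiv.smul g : Z ≃ᵐ Z) f)

theorem integrable_rnCocycle_mul {η : Measure Z} [SigmaFinite η]
    (hq : ∀ g : G, Measure.QuasiMeasurePreserving (fun z : Z => g • z) η η) (g : G) {f : Z → ℝ}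
    (hf : Integrable (fun z => f (g • z)) η) : Integrable (fun z => rnCocycle η g z * f z) η :=
  (integrable_rnDeriv_smul_iff (hq g).absolutelyContinuous).2
    ((integrable_map_equiv (MeasurableEquiv.smul g : Z ≃ᵐ Z) f).2 hf)

/-- A property that holds almost everywhere holds on an invariant measurable conull set, provided
the group is countable and acts non-singularly. -/
theorem exists_invariant_conull [Countable G] {η : Measure Z}
    (hq : ∀ g : G, Measure.QuasiMeasurePreserving (fun z : Z => g • z) η η) {P : Z → Prop}
    (hP : ∀ᵐ z ∂η, P z) :
    ∃ Z₀ : Set Z, MeasurableSet Z₀ ∧ (∀ᵐ z ∂η, z ∈ Z₀) ∧ (∀ g : G, ∀ z ∈ Z₀, g • z ∈ Z₀) ∧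
      ∀ z ∈ Z₀, P z := by
  obtain ⟨s, hs, hsm, hsP⟩ := hP.exists_measurable_mem
  refine ⟨{z | ∀ g : G, g • z ∈ s}, ?_, ?_, ?_, fun z hz => hsP z (by simpa using hz 1)⟩
  · rw [Set.ofPred_forall]
    exact MeasurableSet.iInter fun g => measurable_const_smul g hsm
  · exact ae_all_iff.2 fun g => (hq g).ae hs
  · intro g z hz h
    rw [← mul_smul]
    exact hz _

end Cocycle

/-! ### Increasing finite subrelations and the maximal inequality -/

section Levels

variable {G Z : Type*} [Group G] [MulAction G Z] [MeasurableSpace Z]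

/-- The sum of `T̂^g f (z)` over the finite set `B n z` of group elements. -/
noncomputable def levelSum (η : Measure Z) (B : ℕ → Z → Finset G) (n : ℕ) (f : Z → ℝ) (z : Z) : ℝ :=
  ∑ g ∈ B n z, That η g f z

/-- An increasing sequence of finite subrelations of the orbit relation on the invariant conull set
`Z₀`: the class of `z` in the `n`-th one is `{h⁻¹ • z | h ∈ B n z}`, and `one_mem` and `mem_iff`
make these classes a partition of `Z₀`. The last two fields say that on `Z₀` the Radon–Nikodym cocycle satisfies its identities without exceptional sets. -/
structure IsExhaustion (η : Measure Z) (B : ℕ → Z → Finset G) (Z₀ : Set Z) : Prop where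
  measurableSet_mem : ∀ n g, MeasurableSet {z | g ∈ B n z}
  mono : ∀ z, Monotone fun n => B n z
  bounded : ∀ n, ∃ K : Finset G, ∀ z, B n z ⊆ K
  one_mem : ∀ n z, 1 ∈ B n z
  measurableSet : MeasurableSet Z₀
  conull : ∀ᵐ z ∂η, z ∈ Z₀
  smul_mem : ∀ g : G, ∀ z ∈ Z₀, g • z ∈ Z₀
  mem_iff : ∀ n, ∀ z ∈ Z₀, ∀ h ∈ B n z, ∀ g, g ∈ B n (h⁻¹ • z) ↔ h * g ∈ B n z
  cocycle_one : ∀ z ∈ Z₀, rnCocycle η (1 : G) z = 1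
  cocycle_mul : ∀ z ∈ Z₀, ∀ g h : G,
    rnCocycle η (g * h) z = rnCocycle η g z * rnCocycle η h (g⁻¹ • z)

namespace IsExhaustion

variable {η : Measure Z} {B : ℕ → Z → Finset G} {Z₀ : Set Z} (E : IsExhaustion η B Z₀)
include E

theorem cocycle_pos {z : Z} (hz : z ∈ Z₀) (g : G) : 0 < rnCocycle η g z := by
  have h := E.cocycle_mul z hz g g⁻¹
  rw [mul_inv_cancel, E.cocycle_one z hz] at h
  exact (rnCocycle_nonneg η g z).lt_of_ne fun h0 => by simp [← h0] at h

theorem mem_smul_iff {n : ℕ} {z : Z} (hz : z ∈ Z₀) (g : G) :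
    g ∈ B n (g • z) ↔ g⁻¹ ∈ B n z := by
  constructor
  · intro h
    have := E.mem_iff n (g • z) (E.smul_mem g z hz) g h g⁻¹
    rw [inv_smul_smul, mul_inv_cancel] at this
    exact this.2 (E.one_mem _ _)
  · intro h
    have := E.mem_iff n z hz g⁻¹ h g
    rw [inv_inv, inv_mul_cancel] at this
    exact this.2 (E.one_mem _ _)

/-- The sums over a finite class, seen from two of its points, differ by the cocycle only. -/
theorem levelSum_eq {n : ℕ} {z : Z} (hz : z ∈ Z₀) {h : G} (hh : h ∈ B n z) (f : Z → ℝ) :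
    levelSum η B n f z = rnCocycle η h z * levelSum η B n f (h⁻¹ • z) := by
  rw [levelSum, levelSum, Finset.mul_sum]
  symm
  refine Finset.sum_bij' (fun g _ => h * g) (fun g _ => h⁻¹ * g)
    (fun g hg => (E.mem_iff n z hz h hh g).1 hg)
    (fun g hg => (E.mem_iff n z hz h hh _).2 (by rwa [mul_inv_cancel_left]))
    (fun g _ => inv_mul_cancel_left _ _) (fun g _ => mul_inv_cancel_left _ _) fun g _ => ?_
  change _ * (_ * rnCocycle η g _) = _ * rnCocycle η (h * g) z
  rw [E.cocycle_mul z hz, mul_inv_rev, mul_smul]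
  ring

theorem levelSum_pos {n : ℕ} {z : Z} (hz : z ∈ Z₀) {v : Z → ℝ} (hv : ∀ z ∈ Z₀, 0 < v z) :
    0 < levelSum η B n v z :=
  Finset.sum_pos (fun g _ => mul_pos (hv _ (E.smul_mem _ _ hz)) (E.cocycle_pos hz g))
    ⟨1, E.one_mem n z⟩

theorem le_levelSum {n : ℕ} {z : Z} (hz : z ∈ Z₀) {v : Z → ℝ} (hv : ∀ z ∈ Z₀, 0 < v z) :
    v z ≤ levelSum η B n v z := by
  have h1 : That η (1 : G) v z = v z := by
    change _ * rnCocycle η (1 : G) z = _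
    rw [E.cocycle_one z hz, inv_one, one_smul, mul_one]
  rw [← h1]
  exact Finset.single_le_sum (f := fun g => That η g v z)
    (fun g _ => (mul_pos (hv _ (E.smul_mem _ _ hz)) (E.cocycle_pos hz g)).le) (E.one_mem n z)

theorem ratio_eq {n : ℕ} {z : Z} (hz : z ∈ Z₀) {h : G} (hh : h ∈ B n z) (u v : Z → ℝ) :
    levelSum η B n u (h⁻¹ • z) / levelSum η B n v (h⁻¹ • z) =
      levelSum η B n u z / levelSum η B n v z := by
  rw [E.levelSum_eq hz hh u, E.levelSum_eq hz hh v,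
    mul_div_mul_left _ _ (E.cocycle_pos hz h).ne']

theorem levelSum_nonneg_iff {n : ℕ} {z : Z} (hz : z ∈ Z₀) {h : G} (hh : h ∈ B n z) (f : Z → ℝ) :
    0 ≤ levelSum η B n f (h⁻¹ • z) ↔ 0 ≤ levelSum η B n f z := by
  rw [E.levelSum_eq hz hh f, mul_nonneg_iff_of_pos_left (E.cocycle_pos hz h)]

variable [MeasurableConstSMul G Z]

theorem measurable_levelSum (n : ℕ) {f : Z → ℝ} (hf : Measurable f) :
    Measurable (levelSum η B n f) := by
  classical
  obtain ⟨K, hK⟩ := E.bounded n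
  have : levelSum η B n f = fun z => ∑ g ∈ K, if g ∈ B n z then That η g f z else 0 := by
    funext z
    rw [← Finset.sum_filter, levelSum]
    congr 1
    ext g
    simpa using @hK z g
  rw [this]
  refine Finset.measurable_sum _ fun g _ => Measurable.ite (E.measurableSet_mem n g) ?_
    measurable_const
  exact (hf.comp (measurable_const_smul g⁻¹)).mul (measurable_rnCocycle η g)

/-- Mass transport inside the classes of the `n`-th subrelation: on a set saturated for it, `f` has
the same integral as its average over the classes with respect to the weight `v`. -/
theorem setIntegral_eq [SigmaFinite η]
    (hq : ∀ g : G, Measure.QuasiMeasurePreserving (fun z : Z => g • z) η η)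
    {v f : Z → ℝ} (hvm : Measurable v) (hv : ∀ z ∈ Z₀, 0 < v z) (hfm : Measurable f)
    (hf : Integrable f η) {n : ℕ} {A : Set Z} (hA : MeasurableSet A) (hAZ : A ⊆ Z₀)
    (hinv : ∀ z ∈ A, ∀ h ∈ B n z, h⁻¹ • z ∈ A) :
    ∫ z in A, f z ∂η = ∫ z in A, v z / levelSum η B n v z * levelSum η B n f z ∂η := by
  classical
  obtain ⟨K, hK⟩ := E.bounded n
  let q : Z → ℝ := fun z => v z / levelSum η B n v z
  have hqm : Measurable q := hvm.div (E.measurable_levelSum n hvm)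
  have hq0 : ∀ z ∈ Z₀, 0 ≤ q z := fun z hz => div_nonneg (hv z hz).le (E.levelSum_pos hz hv).le
  have hq1 : ∀ z ∈ Z₀, q z ≤ 1 := fun z hz =>
    div_le_one_of_le₀ (E.le_levelSum hz hv) (E.levelSum_pos hz hv).le
  -- after multiplication by the cocycle, `φ g` is the contribution of `g` to the right-hand side;
  -- changing variables by `g` turns it into a multiple of `f z` with a factor at most `1`
  let φ : G → Z → ℝ := fun g => ({z | z ∈ A ∧ g ∈ B n z}).indicator fun z => q z * f (g⁻¹ • z)
  have hφset : ∀ g, MeasurableSet {z | z ∈ A ∧ g ∈ B n z} := fun g =>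
    hA.inter (E.measurableSet_mem n g)
  have hφm : ∀ g, Measurable (φ g) := fun g =>
    (hqm.mul (hfm.comp (measurable_const_smul g⁻¹))).indicator (hφset g)
  have hφi : ∀ g, Integrable (fun z => φ g (g • z)) η := by
    intro g
    refine hf.norm.mono' ((hφm g).comp (measurable_const_smul g)).aestronglyMeasurable
      (Eventually.of_forall fun z => ?_)
    by_cases hz : g • z ∈ A ∧ g ∈ B n (g • z)
    · have hz0 := hAZ hz.1
      simp only [φ]
      rw [Set.indicator_of_mem (by exact hz), inv_smul_smul, norm_mul,
        Real.norm_of_nonneg (hq0 _ hz0)]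
      exact mul_le_of_le_one_left (norm_nonneg _) (hq1 _ hz0)
    · simp only [φ]
      rw [Set.indicator_of_notMem (by exact hz), norm_zero]
      exact norm_nonneg _
  have hR : ∀ z, A.indicator (fun z => q z * levelSum η B n f z) z =
      ∑ g ∈ K, rnCocycle η g z * φ g z := by
    intro z
    by_cases hz : z ∈ A
    · rw [Set.indicator_of_mem hz, levelSum, Finset.mul_sum, ← Finset.sum_subset (hK z)]
      · refine Finset.sum_congr rfl fun g hg => ?_
        simp only [φ]
        rw [Set.indicator_of_mem (by exact ⟨hz, hg⟩)]
        change _ * (_ * rnCocycle η g z) = _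
        ring
      · intro g _ hg
        simp only [φ]
        rw [Set.indicator_of_notMem (fun h => hg h.2), mul_zero]
    · rw [Set.indicator_of_notMem hz]
      refine (Finset.sum_eq_zero fun g _ => ?_).symm
      simp only [φ]
      rw [Set.indicator_of_notMem (fun h => hz h.1), mul_zero]
  have hL : ∀ z, A.indicator f z = ∑ g ∈ K, φ g (g • z) := by
    intro z
    by_cases hz : z ∈ A
    · have hz0 := hAZ hz
      have hpos := E.levelSum_pos (n := n) hz0 hv
      rw [Set.indicator_of_mem hz]
      -- reindex by the inverse: `g` contributes at `g • z` exactly when `g⁻¹ ∈ B n z`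
      have hmemK : ∀ h ∈ B n z, h⁻¹ ∈ K := fun h hh =>
        hK _ ((E.mem_smul_iff hz0 h⁻¹).2 (by rwa [inv_inv]))
      have hsum : ∑ g ∈ K, φ g (g • z) = ∑ h ∈ B n z, q (h⁻¹ • z) * f z := by
        symm
        refine Finset.sum_of_injOn (fun h => h⁻¹) (inv_injective.injOn) hmemK ?_ ?_
        · intro g _ hg
          simp only [φ]
          refine Set.indicator_of_notMem (fun h => hg ?_) _
          exact ⟨g⁻¹, (E.mem_smul_iff hz0 g).1 h.2, inv_inv g⟩
        · intro h hh
          simp only [φ]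
          rw [Set.indicator_of_mem, inv_smul_smul]
          exact ⟨hinv z hz h hh, (E.mem_smul_iff hz0 h⁻¹).2 (by rwa [inv_inv])⟩
      rw [hsum, ← Finset.sum_mul]
      have : ∑ h ∈ B n z, q (h⁻¹ • z) = 1 := by
        have h1 : ∀ h ∈ B n z, q (h⁻¹ • z) = That η h v z / levelSum η B n v z := by
          intro h hh
          change v _ / _ = v _ * rnCocycle η h z / _
          rw [E.levelSum_eq hz0 hh v, mul_comm (v _),
            mul_div_mul_left _ _ (E.cocycle_pos hz0 h).ne']
        rw [Finset.sum_congr rfl h1, ← Finset.sum_div]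
        exact div_self hpos.ne'
      rw [this, one_mul]
    · rw [Set.indicator_of_notMem hz]
      refine (Finset.sum_eq_zero fun g _ => ?_).symm
      simp only [φ]
      refine Set.indicator_of_notMem (fun h => hz ?_) _
      simpa using hinv _ h.1 g h.2
  rw [← integral_indicator hA, ← integral_indicator hA]
  rw [integral_congr_ae (ae_of_all _ hL), integral_congr_ae (ae_of_all _ hR),
    integral_finsetSum _ fun g _ => hφi g,
    integral_finsetSum _ fun g _ => integrable_rnCocycle_mul hq g (hφi g)]
  exact Finset.sum_congr rfl fun g _ => (integral_rnCocycle_mul hq g _).symm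

/-- A finite-stage maximal inequality, by induction on the stage: split off the part of `A` where
the last sum is nonnegative, which is saturated for the last subrelation. -/
theorem setIntegral_nonneg_of_exists_le [SigmaFinite η]
    (hq : ∀ g : G, Measure.QuasiMeasurePreserving (fun z : Z => g • z) η η)
    {v f : Z → ℝ} (hvm : Measurable v) (hv : ∀ z ∈ Z₀, 0 < v z) (hfm : Measurable f)
    (hf : Integrable f η) (N : ℕ) {A : Set Z} (hA : MeasurableSet A) (hAZ : A ⊆ Z₀)
    (hinv : ∀ z ∈ A, ∀ h ∈ B N z, h⁻¹ • z ∈ A) :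
    0 ≤ ∫ z in A ∩ {z | ∃ k ≤ N, 0 ≤ levelSum η B k f z}, f z ∂η := by
  have hSm : ∀ k, MeasurableSet {z | 0 ≤ levelSum η B k f z} := fun k =>
    measurableSet_le measurable_const (E.measurable_levelSum k hfm)
  have hSm' : ∀ N, MeasurableSet {z | ∃ k ≤ N, 0 ≤ levelSum η B k f z} := by
    intro N
    have : {z | ∃ k ≤ N, 0 ≤ levelSum η B k f z} =
        ⋃ k, ⋃ (_ : k ≤ N), {z | 0 ≤ levelSum η B k f z} := by
      ext z; simp
    rw [this]
    exact MeasurableSet.iUnion fun k => MeasurableSet.iUnion fun _ => hSm k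
  -- the part of a saturated set where the sum of the same level is nonnegative
  have key : ∀ n, ∀ A : Set Z, MeasurableSet A → A ⊆ Z₀ →
      (∀ z ∈ A, ∀ h ∈ B n z, h⁻¹ • z ∈ A) →
      0 ≤ ∫ z in A ∩ {z | 0 ≤ levelSum η B n f z}, f z ∂η := by
    intro n A hA hAZ hinv
    rw [E.setIntegral_eq hq hvm hv hfm hf (n := n) (hA.inter (hSm n))
      (Set.inter_subset_left.trans hAZ) fun z hz h hh =>
        ⟨hinv z hz.1 h hh, (E.levelSum_nonneg_iff (hAZ hz.1) hh f).2 hz.2⟩]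
    refine setIntegral_nonneg (hA.inter (hSm n)) fun z hz => mul_nonneg ?_ hz.2
    exact div_nonneg (hv z (hAZ hz.1)).le (E.levelSum_pos (hAZ hz.1) hv).le
  induction N generalizing A with
  | zero =>
    simpa using key 0 A hA hAZ hinv
  | succ N ih =>
    have hsplit : A ∩ {z | ∃ k ≤ N + 1, 0 ≤ levelSum η B k f z} =
        (A ∩ {z | 0 ≤ levelSum η B (N + 1) f z}) ∪
          ((A \ {z | 0 ≤ levelSum η B (N + 1) f z}) ∩
            {z | ∃ k ≤ N, 0 ≤ levelSum η B k f z}) := by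
      ext z
      simp only [Set.mem_inter_iff, Set.mem_union, Set.mem_sdiff, Set.mem_ofPred_eq]
      constructor
      · rintro ⟨hz, k, hk, hk0⟩
        by_cases h0 : 0 ≤ levelSum η B (N + 1) f z
        · exact Or.inl ⟨hz, h0⟩
        · refine Or.inr ⟨⟨hz, h0⟩, k, ?_, hk0⟩
          rcases Nat.le_succ_iff.1 hk with h | h
          · exact h
          · exact absurd (by rwa [h] at hk0) h0
      · rintro (⟨hz, h0⟩ | ⟨⟨hz, -⟩, k, hk, hk0⟩)
        · exact ⟨hz, N + 1, le_rfl, h0⟩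
        · exact ⟨hz, k, by omega, hk0⟩
    rw [hsplit, setIntegral_union ?_ ((hA.diff (hSm _)).inter (hSm' N)) hf.integrableOn
      hf.integrableOn]
    · refine add_nonneg (key _ A hA hAZ hinv) (ih (hA.diff (hSm _)) (Set.sdiff_subset.trans hAZ) ?_)
      intro z hz h hh
      have hh' := E.mono z (Nat.le_succ N) hh
      exact ⟨hinv z hz.1 h hh', fun h0 => hz.2 ((E.levelSum_nonneg_iff (hAZ hz.1) hh' f).1 h0)⟩
    · exact Set.disjoint_left.2 fun z hz hz' => hz'.1.2 hz.2

/-- The maximal inequality: if at every point of a saturated set `A` some sum of `f` over a finite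
class is nonnegative, then `f` has nonnegative integral over `A`. -/
theorem setIntegral_nonneg [SigmaFinite η]
    (hq : ∀ g : G, Measure.QuasiMeasurePreserving (fun z : Z => g • z) η η)
    {v f : Z → ℝ} (hvm : Measurable v) (hv : ∀ z ∈ Z₀, 0 < v z) (hfm : Measurable f)
    (hf : Integrable f η) {A : Set Z} (hA : MeasurableSet A) (hAZ : A ⊆ Z₀)
    (hinv : ∀ z ∈ A, ∀ n, ∀ h ∈ B n z, h⁻¹ • z ∈ A)
    (hex : ∀ z ∈ A, ∃ n, 0 ≤ levelSum η B n f z) : 0 ≤ ∫ z in A, f z ∂η := by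
  have hU : A = ⋃ N, A ∩ {z | ∃ k ≤ N, 0 ≤ levelSum η B k f z} := by
    ext z
    simp only [Set.mem_iUnion, Set.mem_inter_iff, Set.mem_ofPred_eq]
    constructor
    · intro hz
      obtain ⟨n, hn⟩ := hex z hz
      exact ⟨n, hz, n, le_rfl, hn⟩
    · rintro ⟨_, hz, _⟩
      exact hz
  have hmono : Monotone fun N => A ∩ {z | ∃ k ≤ N, 0 ≤ levelSum η B k f z} := by
    intro M N hMN z hz
    obtain ⟨hz, k, hk, h0⟩ := hz
    exact ⟨hz, k, hk.trans hMN, h0⟩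
  have hm : ∀ N, MeasurableSet (A ∩ {z | ∃ k ≤ N, 0 ≤ levelSum η B k f z}) := by
    intro N
    have : {z | ∃ k ≤ N, 0 ≤ levelSum η B k f z} =
        ⋃ k, ⋃ (_ : k ≤ N), {z | 0 ≤ levelSum η B k f z} := by
      ext z; simp
    rw [this]
    exact hA.inter (MeasurableSet.iUnion fun k => MeasurableSet.iUnion fun _ =>
      measurableSet_le measurable_const (E.measurable_levelSum k hfm))
  have ht := tendsto_setIntegral_of_monotone (f := f) (μ := η) hm hmono hf.integrableOn
  rw [← hU] at ht
  exact ge_of_tendsto' ht fun N =>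
    E.setIntegral_nonneg_of_exists_le hq hvm hv hfm hf N hA hAZ fun z hz => hinv z hz N

end IsExhaustion
end Levels
/-! ### The ratio ergodic theorem for an exhaustion by finite subrelations -/

theorem measurableSet_frequently_atTop {Z : Type*} [MeasurableSpace Z] {p : ℕ → Z → Prop}
    (hp : ∀ n, MeasurableSet {z | p n z}) : MeasurableSet {z | ∃ᶠ n in atTop, p n z} := by
  have : {z | ∃ᶠ n in atTop, p n z} = ⋂ N, ⋃ n, ⋃ (_ : N ≤ n), {z | p n z} := by
    ext z; simp [frequently_atTop]
  rw [this]
  exact MeasurableSet.iInter fun N => MeasurableSet.iUnion fun n =>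
    MeasurableSet.iUnion fun _ => hp n

/-- A real sequence converges as soon as it does not cross any rational interval infinitely often,
and is neither frequently above every natural number nor frequently below every negative one. -/
theorem exists_tendsto_of_frequently {x : ℕ → ℝ}
    (hcross : ∀ a b : ℚ, a < b → ¬((∃ᶠ n in atTop, x n < a) ∧ ∃ᶠ n in atTop, (b : ℝ) < x n))
    (htop : ¬∀ m : ℕ, ∃ᶠ n in atTop, (m : ℝ) < x n)
    (hbot : ¬∀ m : ℕ, ∃ᶠ n in atTop, x n < -(m : ℝ)) : ∃ c, Tendsto x atTop (𝓝 c) := by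
  push Not at htop hbot
  obtain ⟨M, hM⟩ := htop
  obtain ⟨m, hm⟩ := hbot
  refine tendsto_of_no_upcrossings (s := Set.range ((↑) : ℚ → ℝ)) Rat.denseRange_cast ?_
    ⟨M, ?_⟩ ⟨-m, ?_⟩
  · rintro _ ⟨a, rfl⟩ _ ⟨b, rfl⟩ hab
    exact hcross a b (by exact_mod_cast hab)
  · simpa using hM
  · simpa using hm

theorem measure_eq_zero_of_setIntegral_nonpos {Z : Type*} [MeasurableSpace Z] {η : Measure Z}
    {v : Z → ℝ} (hvi : Integrable v η) {A : Set Z} (hA : MeasurableSet A) (hv : ∀ z ∈ A, 0 < v z)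
    (h : ∫ z in A, v z ∂η ≤ 0) : η A = 0 := by
  by_contra h0
  have hpos : 0 < ∫ z in A, v z ∂η := by
    rw [setIntegral_pos_iff_support_of_nonneg_ae
      ((ae_restrict_iff' hA).2 (ae_of_all _ fun z hz => (hv z hz).le)) hvi.integrableOn]
    have : Function.support v ∩ A = A := Set.inter_eq_right.2 fun z hz => (hv z hz).ne'
    rw [this]
    exact pos_iff_ne_zero.2 h0
  linarith

section Ratio

variable {G Z : Type*} [Group G] [MulAction G Z] [MeasurableSpace Z]

namespace IsExhaustion

variable {η : Measure Z} {B : ℕ → Z → Finset G} {Z₀ : Set Z} (E : IsExhaustion η B Z₀)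
include E

/-- From some index on, the ratios at two equivalent points coincide. -/
theorem ratio_eventuallyEq {z : Z} (hz : z ∈ Z₀) {n : ℕ} {h : G} (hh : h ∈ B n z) (u v : Z → ℝ) :
    (fun k => levelSum η B k u (h⁻¹ • z) / levelSum η B k v (h⁻¹ • z)) =ᶠ[atTop]
      fun k => levelSum η B k u z / levelSum η B k v z := by
  filter_upwards [eventually_ge_atTop n] with k hk
  exact E.ratio_eq hz (E.mono z hk hh) u v

variable [MeasurableConstSMul G Z] [SigmaFinite η]
  (hq : ∀ g : G, Measure.QuasiMeasurePreserving (fun z : Z => g • z) η η)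
  {u v : Z → ℝ} (hum : Measurable u) (hu : Integrable u η) (hvm : Measurable v)
  (hvi : Integrable v η) (hv : ∀ z ∈ Z₀, 0 < v z)
include hq hum hu hvm hvi hv

theorem mul_setIntegral_le {A : Set Z} (hA : MeasurableSet A) (hAZ : A ⊆ Z₀)
    (hinv : ∀ z ∈ A, ∀ n, ∀ h ∈ B n z, h⁻¹ • z ∈ A) (b : ℝ)
    (hex : ∀ z ∈ A, ∃ n, b ≤ levelSum η B n u z / levelSum η B n v z) :
    b * ∫ z in A, v z ∂η ≤ ∫ z in A, u z ∂η := by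
  have h := E.setIntegral_nonneg hq hvm hv (f := fun z => u z - b * v z)
    (hum.sub (hvm.const_mul b)) (hu.sub (hvi.const_mul b)) hA hAZ hinv ?_
  · rw [integral_sub hu.integrableOn (hvi.const_mul b).integrableOn, integral_const_mul] at h
    linarith
  · intro z hz
    obtain ⟨n, hn⟩ := hex z hz
    rw [le_div_iff₀ (E.levelSum_pos (hAZ hz) hv)] at hn
    refine ⟨n, ?_⟩
    have : levelSum η B n (fun z => u z - b * v z) z =
        levelSum η B n u z - b * levelSum η B n v z := by
      simp only [levelSum, Finset.mul_sum, ← Finset.sum_sub_distrib, That]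
      exact Finset.sum_congr rfl fun g _ => by ring
    rw [this]
    linarith

theorem setIntegral_le_mul {A : Set Z} (hA : MeasurableSet A) (hAZ : A ⊆ Z₀)
    (hinv : ∀ z ∈ A, ∀ n, ∀ h ∈ B n z, h⁻¹ • z ∈ A) (a : ℝ)
    (hex : ∀ z ∈ A, ∃ n, levelSum η B n u z / levelSum η B n v z ≤ a) :
    ∫ z in A, u z ∂η ≤ a * ∫ z in A, v z ∂η := by
  have h := E.mul_setIntegral_le hq (u := fun z => -u z) hum.neg hu.neg hvm hvi hv hA hAZ hinv (-a)
    fun z hz => ?_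
  · rw [integral_neg] at h
    linarith
  · obtain ⟨n, hn⟩ := hex z hz
    refine ⟨n, ?_⟩
    have : levelSum η B n (fun z => -u z) z = -levelSum η B n u z := by
      simp [levelSum, That]
    rw [this, neg_div]
    exact neg_le_neg hn

theorem ae_exists_tendsto_ratio :
    ∀ᵐ z ∂η, ∃ c, Tendsto (fun n => levelSum η B n u z / levelSum η B n v z) atTop (𝓝 c) := by
  set M : ℕ → Z → ℝ := fun n z => levelSum η B n u z / levelSum η B n v z
  have hMm : ∀ n, Measurable (M n) := fun n =>
    (E.measurable_levelSum n hum).div (E.measurable_levelSum n hvm)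
  have hlt : ∀ a : ℝ, MeasurableSet {z | ∃ᶠ n in atTop, M n z < a} := fun a =>
    measurableSet_frequently_atTop fun n => measurableSet_lt (hMm n) measurable_const
  have hgt : ∀ b : ℝ, MeasurableSet {z | ∃ᶠ n in atTop, b < M n z} := fun b =>
    measurableSet_frequently_atTop fun n => measurableSet_lt measurable_const (hMm n)
  have hfreq : ∀ (p : ℝ → Prop) (z : Z), z ∈ Z₀ → ∀ n, ∀ h ∈ B n z,
      (∃ᶠ n in atTop, p (M n z)) → ∃ᶠ n in atTop, p (M n (h⁻¹ • z)) := by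
    intro p z hz n h hh hf
    refine hf.mp ((E.ratio_eventuallyEq hz hh u v).mono fun k hk hp => ?_)
    have hk' : M k (h⁻¹ • z) = M k z := hk
    rwa [hk']
  -- on the saturated set `A` of points with infinitely many crossings, the maximal inequality
  -- gives `b ∫ v ≤ ∫ u ≤ a ∫ v`
  have hcross : ∀ a b : ℚ, a < b →
      ∀ᵐ z ∂η, ¬((∃ᶠ n in atTop, M n z < a) ∧ ∃ᶠ n in atTop, (b : ℝ) < M n z) := by
    intro a b hab
    set A := Z₀ ∩ ({z | ∃ᶠ n in atTop, M n z < a} ∩ {z | ∃ᶠ n in atTop, (b : ℝ) < M n z})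
    have hA : MeasurableSet A := E.measurableSet.inter ((hlt a).inter (hgt b))
    have hAZ : A ⊆ Z₀ := Set.inter_subset_left
    have hinv : ∀ z ∈ A, ∀ n, ∀ h ∈ B n z, h⁻¹ • z ∈ A := fun z hz n h hh =>
      ⟨E.smul_mem _ _ hz.1, hfreq (· < (a : ℝ)) z hz.1 n h hh hz.2.1,
        hfreq ((b : ℝ) < ·) z hz.1 n h hh hz.2.2⟩
    have h1 := E.mul_setIntegral_le hq hum hu hvm hvi hv hA hAZ hinv b fun z hz =>
      hz.2.2.exists.imp fun n hn => hn.le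
    have h2 := E.setIntegral_le_mul hq hum hu hvm hvi hv hA hAZ hinv a fun z hz =>
      hz.2.1.exists.imp fun n hn => hn.le
    have hab' : (a : ℝ) < b := by exact_mod_cast hab
    have h0 : η A = 0 := measure_eq_zero_of_setIntegral_nonpos hvi hA
      (fun z hz => hv z (hAZ hz)) (by nlinarith)
    filter_upwards [E.conull, measure_eq_zero_iff_ae_notMem.1 h0] with z hz hzA hc
    exact hzA ⟨hz, hc⟩
  have htop : ∀ᵐ z ∂η, ¬∀ m : ℕ, ∃ᶠ n in atTop, (m : ℝ) < M n z := by
    set A := Z₀ ∩ ⋂ m : ℕ, {z | ∃ᶠ n in atTop, (m : ℝ) < M n z}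
    have hA : MeasurableSet A := E.measurableSet.inter (MeasurableSet.iInter fun m => hgt m)
    have hAZ : A ⊆ Z₀ := Set.inter_subset_left
    have hinv : ∀ z ∈ A, ∀ n, ∀ h ∈ B n z, h⁻¹ • z ∈ A := fun z hz n h hh =>
      ⟨E.smul_mem _ _ hz.1, Set.mem_iInter.2 fun m =>
        hfreq ((m : ℝ) < ·) z hz.1 n h hh (Set.mem_iInter.1 hz.2 m)⟩
    have h1 : ∀ m : ℕ, (m : ℝ) * ∫ z in A, v z ∂η ≤ ∫ z in A, u z ∂η := fun m =>
      E.mul_setIntegral_le hq hum hu hvm hvi hv hA hAZ hinv m fun z hz =>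
        (Set.mem_iInter.1 hz.2 m : ∃ᶠ n in atTop, (m : ℝ) < M n z).exists.imp fun n hn => hn.le
    have h0 : η A = 0 := by
      refine measure_eq_zero_of_setIntegral_nonpos hvi hA (fun z hz => hv z (hAZ hz))
        (not_lt.1 fun hpos => ?_)
      obtain ⟨m, hm⟩ := exists_nat_gt ((∫ z in A, u z ∂η) / ∫ z in A, v z ∂η)
      rw [div_lt_iff₀ hpos] at hm
      exact absurd (h1 m) hm.not_ge
    filter_upwards [E.conull, measure_eq_zero_iff_ae_notMem.1 h0] with z hz hzA hc
    exact hzA ⟨hz, Set.mem_iInter.2 hc⟩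
  have hbot : ∀ᵐ z ∂η, ¬∀ m : ℕ, ∃ᶠ n in atTop, M n z < -(m : ℝ) := by
    set A := Z₀ ∩ ⋂ m : ℕ, {z | ∃ᶠ n in atTop, M n z < -(m : ℝ)}
    have hA : MeasurableSet A := E.measurableSet.inter (MeasurableSet.iInter fun m => hlt _)
    have hAZ : A ⊆ Z₀ := Set.inter_subset_left
    have hinv : ∀ z ∈ A, ∀ n, ∀ h ∈ B n z, h⁻¹ • z ∈ A := fun z hz n h hh =>
      ⟨E.smul_mem _ _ hz.1, Set.mem_iInter.2 fun m =>
        hfreq (· < -(m : ℝ)) z hz.1 n h hh (Set.mem_iInter.1 hz.2 m)⟩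
    have h1 : ∀ m : ℕ, ∫ z in A, u z ∂η ≤ -(m : ℝ) * ∫ z in A, v z ∂η := fun m =>
      E.setIntegral_le_mul hq hum hu hvm hvi hv hA hAZ hinv _ fun z hz =>
        (Set.mem_iInter.1 hz.2 m : ∃ᶠ n in atTop, M n z < -(m : ℝ)).exists.imp fun n hn => hn.le
    have h0 : η A = 0 := by
      refine measure_eq_zero_of_setIntegral_nonpos hvi hA (fun z hz => hv z (hAZ hz))
        (not_lt.1 fun hpos => ?_)
      obtain ⟨m, hm⟩ := exists_nat_gt (-(∫ z in A, u z ∂η) / ∫ z in A, v z ∂η)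
      rw [div_lt_iff₀ hpos] at hm
      linarith [h1 m]
    filter_upwards [E.conull, measure_eq_zero_iff_ae_notMem.1 h0] with z hz hzA hc
    exact hzA ⟨hz, Set.mem_iInter.2 hc⟩
  have hcross' : ∀ᵐ z ∂η, ∀ a b : ℚ, a < b →
      ¬((∃ᶠ n in atTop, M n z < a) ∧ ∃ᶠ n in atTop, (b : ℝ) < M n z) := by
    simp only [ae_all_iff]
    exact fun a b hab => hcross a b hab
  filter_upwards [hcross', htop, hbot] with z h1 h2 h3
  exact exists_tendsto_of_frequently h1 h2 h3

/-- The ratio ergodic theorem for an increasing sequence of finite subrelations. -/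
theorem exists_ratio_limit :
    ∃ ρ : Z → ℝ, Measurable ρ ∧ (∀ z, ∀ n, ∀ h ∈ B n z, ρ (h⁻¹ • z) = ρ z) ∧
      (∀ᵐ z ∂η, Tendsto (fun n => levelSum η B n u z / levelSum η B n v z) atTop (𝓝 (ρ z))) ∧
      (RelErgodic (fun z z' => ∃ n, ∃ h ∈ B n z, z' = h⁻¹ • z) η →
        ∀ᵐ z ∂η, ρ z = (∫ y, u y ∂η) / ∫ y, v y ∂η) := by
  classical
  set M : ℕ → Z → ℝ := fun n z => levelSum η B n u z / levelSum η B n v z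
  have hMm : ∀ n, Measurable (M n) := fun n =>
    (E.measurable_levelSum n hum).div (E.measurable_levelSum n hvm)
  set Z₁ : Set Z := Z₀ ∩ {z | ∃ c, Tendsto (fun n => M n z) atTop (𝓝 c)}
  have hZ₁m : MeasurableSet Z₁ := E.measurableSet.inter (measurableSet_exists_tendsto hMm)
  have hZ₁0 : ∀ᵐ z ∂η, z ∈ Z₁ :=
    E.conull.and (E.ae_exists_tendsto_ratio hq hum hu hvm hvi hv)
  have hex : ∀ z, ∃ c, Tendsto (fun n => Z₁.indicator (M n) z) atTop (𝓝 c) := by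
    intro z
    by_cases hz : z ∈ Z₁
    · simp only [Set.indicator_of_mem hz]
      exact hz.2
    · simpa only [Set.indicator_of_notMem hz] using ⟨0, tendsto_const_nhds⟩
  -- `ρ` vanishes off `Z₁`, which makes it measurable and invariant without exceptional sets
  choose ρ hρ using hex
  have hρm : Measurable ρ :=
    measurable_of_tendsto_metrizable (fun n => (hMm n).indicator hZ₁m) (tendsto_pi_nhds.2 hρ)
  have hρ1 : ∀ z ∈ Z₁, Tendsto (fun n => M n z) atTop (𝓝 (ρ z)) := by
    intro z hz
    simpa only [Set.indicator_of_mem hz] using hρ z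
  have hρ0 : ∀ z ∉ Z₁, ρ z = 0 := by
    intro z hz
    have h := hρ z
    simp only [Set.indicator_of_notMem hz] at h
    exact tendsto_nhds_unique h tendsto_const_nhds
  have hρinv : ∀ z, ∀ n, ∀ h ∈ B n z, ρ (h⁻¹ • z) = ρ z := by
    intro z n h hh
    by_cases hz0 : z ∈ Z₀
    · have heq := E.ratio_eventuallyEq hz0 hh u v
      have hz0' := E.smul_mem h⁻¹ z hz0
      by_cases hz : z ∈ Z₁
      · have ht : Tendsto (fun n => M n (h⁻¹ • z)) atTop (𝓝 (ρ z)) := (hρ1 z hz).congr' heq.symm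
        exact tendsto_nhds_unique (hρ1 _ ⟨hz0', _, ht⟩) ht
      · rw [hρ0 z hz, hρ0]
        rintro ⟨-, c, hc⟩
        exact hz ⟨hz0, c, hc.congr' heq⟩
    · have hz0' : h⁻¹ • z ∉ Z₀ := fun h' => hz0 (by simpa using E.smul_mem h _ h')
      rw [hρ0 z fun h' => hz0 h'.1, hρ0 _ fun h' => hz0' h'.1]
  refine ⟨ρ, hρm, hρinv, hZ₁0.mono hρ1, fun herg => ?_⟩
  -- an invariant measurable set defined by `ρ` that is conull carries the full integrals
  have hfull : ∀ s : Set ℝ, MeasurableSet s → (∀ᵐ z ∂η, ρ z ∉ s) ∨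
      ∀ f : Z → ℝ, ∫ z in Z₁ ∩ ρ ⁻¹' s, f z ∂η = ∫ z, f z ∂η := by
    intro s hs
    have hsat : ∀ z z', (∃ n, ∃ h ∈ B n z, z' = h⁻¹ • z) → (z ∈ ρ ⁻¹' s ↔ z' ∈ ρ ⁻¹' s) := by
      rintro z _ ⟨n, h, hh, rfl⟩
      rw [Set.mem_preimage, Set.mem_preimage, hρinv z n h hh]
    rcases herg (ρ ⁻¹' s) (hρm hs) hsat with h | h
    · exact Or.inl (measure_eq_zero_iff_ae_notMem.1 h)
    · refine Or.inr fun f => ?_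
      have hae : ∀ᵐ z ∂η, z ∈ ρ ⁻¹' s := by
        filter_upwards [measure_eq_zero_iff_ae_notMem.1 h] with z hz
        exact not_not.1 hz
      have hae' : ∀ᵐ z ∂η, z ∈ Z₁ ∩ ρ ⁻¹' s := hZ₁0.and hae
      rw [Measure.restrict_eq_self_of_ae_mem hae']
  have hsub : ∀ s : Set ℝ, Z₁ ∩ ρ ⁻¹' s ⊆ Z₀ := fun s z hz => hz.1.1
  have hinv : ∀ s : Set ℝ, ∀ z ∈ Z₁ ∩ ρ ⁻¹' s, ∀ n, ∀ h ∈ B n z, h⁻¹ • z ∈ Z₁ ∩ ρ ⁻¹' s := by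
    intro s z hz n h hh
    refine ⟨⟨E.smul_mem _ _ hz.1.1, ρ z, ?_⟩, ?_⟩
    · exact (hρ1 z hz.1).congr' (E.ratio_eventuallyEq hz.1.1 hh u v).symm
    · rw [Set.mem_preimage, hρinv z n h hh]
      exact hz.2
  by_cases hη : η = 0
  · simp [hη]
  have hvpos : 0 < ∫ y, v y ∂η := by
    by_contra h
    have hZ₀ : ∫ z in Z₀, v z ∂η = ∫ z, v z ∂η := by
      rw [Measure.restrict_eq_self_of_ae_mem E.conull]
    have h0 := measure_eq_zero_of_setIntegral_nonpos hvi E.measurableSet hv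
      (hZ₀.trans_le (not_lt.1 h))
    have h1 : ∀ᵐ z ∂η, False := by
      filter_upwards [E.conull, measure_eq_zero_iff_ae_notMem.1 h0] with z h1 h2 using h2 h1
    exact hη (ae_eq_bot.1 (eventually_false_iff_eq_bot.1 h1))
  set c₀ := (∫ y, u y ∂η) / ∫ y, v y ∂η
  have hup : ∀ c : ℚ, c₀ < c → ∀ᵐ z ∂η, ¬(c : ℝ) < ρ z := by
    intro c hc
    refine (hfull (Set.Ioi (c : ℝ)) measurableSet_Ioi).resolve_right fun hf => ?_
    have h := E.mul_setIntegral_le hq hum hu hvm hvi hv (hZ₁m.inter (hρm measurableSet_Ioi))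
      (hsub _) (hinv _) c fun z hz =>
        ((hρ1 z hz.1).eventually_const_lt hz.2).exists.imp fun n hn => hn.le
    rw [hf, hf, ← le_div_iff₀ hvpos] at h
    exact h.not_gt hc
  have hdown : ∀ c : ℚ, c < c₀ → ∀ᵐ z ∂η, ¬ρ z < (c : ℝ) := by
    intro c hc
    refine (hfull (Set.Iio (c : ℝ)) measurableSet_Iio).resolve_right fun hf => ?_
    have h := E.setIntegral_le_mul hq hum hu hvm hvi hv (hZ₁m.inter (hρm measurableSet_Iio))
      (hsub _) (hinv _) c fun z hz =>
        ((hρ1 z hz.1).eventually_lt_const hz.2).exists.imp fun n hn => hn.le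
    rw [hf, hf, ← div_le_iff₀ hvpos] at h
    exact h.not_gt hc
  have hup' : ∀ᵐ z ∂η, ∀ c : ℚ, c₀ < c → ¬(c : ℝ) < ρ z := by
    simp only [ae_all_iff]
    exact hup
  have hdown' : ∀ᵐ z ∂η, ∀ c : ℚ, c < c₀ → ¬ρ z < (c : ℝ) := by
    simp only [ae_all_iff]
    exact hdown
  filter_upwards [hup', hdown'] with z h1 h2
  refine le_antisymm (not_lt.1 fun h => ?_) (not_lt.1 fun h => ?_)
  · obtain ⟨c, hc1, hc2⟩ := exists_rat_btwn h
    exact h1 c hc1 hc2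
  · obtain ⟨c, hc1, hc2⟩ := exists_rat_btwn h
    exact h2 c hc2 hc1

end IsExhaustion
end Ratio
/-! ### Horospherical balls as classes of finite tail relations -/

section Words

variable {r : ℕ}

/-- Eventually periodic boundary points, the only ones with a nontrivial stabilizer. -/
def EventuallyPeriodic (ξ : Boundary r) : Prop :=
  ∃ p, 0 < p ∧ ∃ N, ∀ i ≥ N, ξ.1 (i + p) = ξ.1 i

/-- Every word splits at the place where its cancellation against `ξ` stops. -/
theorem exists_maximal_cancellation (w : List (Letter r)) (ξ : Boundary r) :
    ∃ (k : ℕ) (t : List (Letter r)),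
      w = t ++ ((List.range k).map fun i => Letter.inv (ξ.1 i)).reverse ∧
        ∀ s ∈ t.getLast?, ξ.1 k ≠ Letter.inv s := by
  classical
  let P : ℕ → Prop := fun k => ∃ t : List (Letter r),
    w = t ++ ((List.range k).map fun i => Letter.inv (ξ.1 i)).reverse
  have hP0 : P 0 := ⟨w, by simp⟩
  have hP := Nat.findGreatest_spec (P := P) (Nat.zero_le w.length) hP0
  set k := Nat.findGreatest P w.length
  obtain ⟨t, ht⟩ := hP
  refine ⟨k, t, ht, fun s hs heq => ?_⟩
  obtain ⟨t', rfl⟩ := List.mem_getLast?_eq_getLast hs |>.elim fun h h' =>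
    (⟨t.dropLast, by rw [h', List.dropLast_append_getLast h]⟩ : ∃ t', t = t' ++ [s])
  have hP' : P (k + 1) := by
    refine ⟨t', ?_⟩
    have h1 : ((List.range (k + 1)).map fun i => Letter.inv (ξ.1 i)).reverse =
        s :: ((List.range k).map fun i => Letter.inv (ξ.1 i)).reverse := by
      rw [List.range_succ, List.map_append, List.reverse_append, List.map_singleton,
        show Letter.inv (ξ.1 k) = s from (congrArg Letter.inv heq).trans (Letter.inv_inv s)]
      rfl
    rw [ht, h1, List.append_assoc, List.singleton_append]
  have hlen : k + 1 ≤ w.length := by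
    rw [ht]; simp
  have := Nat.le_findGreatest hlen hP'
  omega

theorem eventuallyPeriodic_of_shift_eq {ξ : Boundary r} {m k N : ℕ} (hmk : m ≠ k)
    (h : ∀ i ≥ N, m ≤ i → ξ.1 (i - m + k) = ξ.1 i) : EventuallyPeriodic ξ := by
  rcases lt_or_gt_of_ne hmk with hlt | hlt
  · refine ⟨k - m, by omega, N + m, fun i hi => ?_⟩
    rw [← h i (by omega) (by omega)]
    exact congrArg ξ.1 (by omega)
  · refine ⟨m - k, by omega, N + m, fun i hi => ?_⟩
    rw [← h (i + (m - k)) (by omega) (by omega)]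
    exact congrArg ξ.1 (by omega)

/-- For points that are not eventually periodic the balls in `H_ξ` are classes of the finite tail
relations. For eventually periodic `ξ` this fails: `H_ξ` then contains the whole stabilizer of `ξ`,
an infinite group, so no ball contains every `g` with `g⁻¹ • ξ = ξ`. -/
theorem mem_horoBall_iff {ξ : Boundary r} (hξ : ¬EventuallyPeriodic ξ) (n : ℕ) (g : F r) :
    g ∈ horoBall ξ n ↔ ∀ i ≥ n, (g⁻¹ • ξ).1 i = ξ.1 i := by
  obtain ⟨k, t, hw, hk⟩ := exists_maximal_cancellation (g⁻¹).toWord ξ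
  have hact := smul_eq_append g⁻¹ ξ k t hw hk
  have hnorm : g.norm = t.length + k := by
    rw [← FreeGroup.norm_inv_eq, FreeGroup.norm, hw]
    simp
  -- agreement of the tails forces as many letters to be added as are cancelled
  have hlen : ∀ N, (∀ i ≥ N, (g⁻¹ • ξ).1 i = ξ.1 i) → t.length = k := by
    intro N hN
    by_contra hne
    refine hξ (eventuallyPeriodic_of_shift_eq (N := N) hne fun i hi hi' => ?_)
    rw [← hN i hi, hact i, dif_neg (by omega)]
  constructor
  · rintro ⟨⟨N, hN⟩, hn⟩ i hi
    have hl := hlen N fun i hi => (hN i hi).symm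
    rw [hact i, dif_neg (by omega)]
    exact congrArg ξ.1 (by omega)
  · intro h
    have hl := hlen n h
    refine ⟨⟨n, fun i hi => (h i hi).symm⟩, ?_⟩
    by_contra hgt
    have hk0 : k - 1 < t.length := by omega
    have hlast : t[k - 1] = ξ.1 (k - 1) := by
      rw [← h (k - 1) (by omega), hact, dif_pos hk0]
    -- the last added letter would cancel with the neighbouring letter of the reduced word
    have hred : FreeGroup.IsReduced (g⁻¹).toWord := FreeGroup.isReduced_toWord
    rw [hw] at hred
    have hchain := (List.isChain_append.1 hred).2.2 (ξ.1 (k - 1)) (by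
      rw [List.getLast?_eq_getElem?, hl, List.getElem?_eq_getElem hk0, hlast]; rfl)
      (Letter.inv (ξ.1 (k - 1))) (by
        obtain ⟨j, rfl⟩ : ∃ j, k = j + 1 := ⟨k - 1, by omega⟩
        simp [List.range_succ]) rfl
    simp [Letter.inv] at hchain

theorem horoBall_mono (ξ : Boundary r) : Monotone (horoBall ξ) :=
  fun _ _ hmn _ hg => ⟨hg.1, hg.2.trans (Nat.mul_le_mul_left 2 hmn)⟩

theorem one_mem_horoBall (ξ : Boundary r) (n : ℕ) : 1 ∈ horoBall ξ n :=
  ⟨⟨0, fun i _ => by rw [inv_one, one_smul]⟩, by simp⟩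

theorem mem_horosphere_iff {ξ : Boundary r} {g : F r} :
    g ∈ horosphere ξ ↔ ∃ n, g ∈ horoBall ξ n :=
  ⟨fun h => ⟨g.norm, h, by omega⟩, fun ⟨_, h⟩ => h.1⟩

theorem measurable_letter (i : ℕ) : Measurable fun ξ : Boundary r => ξ.1 i :=
  (measurable_pi_apply i).comp measurable_subtype_coe

theorem measurableSet_mem_horoBall (n : ℕ) (g : F r) :
    MeasurableSet {ξ : Boundary r | g ∈ horoBall ξ n} := by
  have : {ξ : Boundary r | g ∈ horoBall ξ n} =
      (⋃ N, ⋂ i, ⋂ (_ : N ≤ i), {ξ : Boundary r | ξ.1 i = (g⁻¹ • ξ).1 i}) ∩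
        {_ξ | g.norm ≤ 2 * n} := by
    ext ξ
    simp [horoBall, horosphere, TailRel]
  rw [this]
  refine (MeasurableSet.iUnion fun N => MeasurableSet.iInter fun i => MeasurableSet.iInter fun _ =>
    ?_).inter (MeasurableSet.const _)
  exact measurableSet_eq_fun (measurable_letter i)
    ((measurable_letter i).comp (measurable_boundary_smul g⁻¹))

end Words

/-! ### The Markov measure is non-atomic and quasi-invariant -/

section Measure

variable {r : ℕ}

/-- The boundary points whose first `m + 1` letters are those of `ζ`. -/
def cyl (m : ℕ) (ζ : Boundary r) : Set (Boundary r) :=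
  {ξ | ∀ i ≤ m, ξ.1 i = ζ.1 i}

theorem measurableSet_cyl (m : ℕ) (ζ : Boundary r) : MeasurableSet (cyl m ζ) := by
  have : cyl m ζ = ⋂ i, ⋂ (_ : i ≤ m), (fun ξ : Boundary r => ξ.1 i) ⁻¹' {ζ.1 i} := by
    ext ξ; simp [cyl]
  rw [this]
  exact MeasurableSet.iInter fun i => MeasurableSet.iInter fun _ =>
    measurable_letter i (measurableSet_singleton _)

theorem finite_range_cyl (m : ℕ) : (Set.range (cyl (r := r) m)).Finite := by
  have : Set.range (cyl (r := r) m) ⊆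
      Set.range fun w : Fin (m + 1) → Letter r => {ξ : Boundary r | ∀ i, ξ.1 i.1 = w i} := by
    rintro _ ⟨ζ, rfl⟩
    refine ⟨fun i => ζ.1 i, ?_⟩
    ext ξ
    exact ⟨fun h i hi => h ⟨i, by omega⟩, fun h i => h i (by omega)⟩
  exact (Set.finite_range _).subset this

theorem isPiSystem_cyl : IsPiSystem {S : Set (Boundary r) | ∃ m ζ, S = cyl (m + 1) ζ} := by
  rintro _ ⟨m, ζ, rfl⟩ _ ⟨m', ζ', rfl⟩ ⟨ω, hω, hω'⟩
  refine ⟨max m m', ω, ?_⟩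
  ext ξ
  constructor
  · rintro ⟨h, h'⟩ i hi
    rcases le_total m m' with hm | hm
    · rw [h' i (by omega), hω' i (by omega)]
    · rw [h i (by omega), hω i (by omega)]
  · intro h
    exact ⟨fun i hi => by rw [h i (by omega), hω i hi],
      fun i hi => by rw [h i (by omega), hω' i hi]⟩

theorem generateFrom_cyl :
    (inferInstance : MeasurableSpace (Boundary r)) =
      MeasurableSpace.generateFrom {S : Set (Boundary r) | ∃ m ζ, S = cyl (m + 1) ζ} := by
  apply le_antisymm
  · have key : ∀ i, Measurable[MeasurableSpace.generateFrom
        {S : Set (Boundary r) | ∃ m ζ, S = cyl (m + 1) ζ}] fun ξ : Boundary r => ξ.1 i := by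
      intro i
      refine @measurable_to_countable' _ _ _ _ (MeasurableSpace.generateFrom _) _ fun s => ?_
      have : (fun ξ : Boundary r => ξ.1 i) ⁻¹' {s} =
          ⋃₀ {S | S ∈ Set.range (cyl (r := r) (i + 1)) ∧
            S ⊆ (fun ξ : Boundary r => ξ.1 i) ⁻¹' {s}} := by
        ext ξ
        constructor
        · intro h
          refine ⟨cyl (i + 1) ξ, ⟨⟨ξ, rfl⟩, fun ω hω => ?_⟩, fun _ _ => rfl⟩
          rw [Set.mem_preimage, hω i (by omega)]
          exact h
        · rintro ⟨S, ⟨-, hS⟩, hξ⟩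
          exact hS hξ
      rw [this]
      refine @MeasurableSet.sUnion _ (MeasurableSpace.generateFrom _) _
        ((finite_range_cyl (i + 1)).subset fun S hS => hS.1).countable ?_
      rintro _ ⟨⟨ζ, rfl⟩, -⟩
      exact MeasurableSpace.measurableSet_generateFrom ⟨i, ζ, rfl⟩
    have hv : Measurable[MeasurableSpace.generateFrom
        {S : Set (Boundary r) | ∃ m ζ, S = cyl (m + 1) ζ}] fun ξ : Boundary r => ξ.1 :=
      @measurable_pi_lambda _ _ _ (MeasurableSpace.generateFrom _) _ _ key
    exact hv.comap_le
  · refine MeasurableSpace.generateFrom_le ?_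
    rintro _ ⟨m, ζ, rfl⟩
    exact measurableSet_cyl _ _

theorem boundaryMeasure_cyl (hr : 2 ≤ r) (m : ℕ) (ζ : Boundary r) :
    boundaryMeasure hr (cyl m ζ) = (2 * r : ENNReal)⁻¹ * ((2 * r - 1 : ℕ) : ENNReal)⁻¹ ^ m :=
  boundaryMeasure_cylinder hr m ζ.1 fun i _ => ζ.2 i

theorem boundaryMeasure_singleton (hr : 2 ≤ r) (ζ : Boundary r) : boundaryMeasure hr {ζ} = 0 := by
  have h1 : ((2 * r - 1 : ℕ) : ENNReal)⁻¹ < 1 := by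
    rw [ENNReal.inv_lt_one]
    exact_mod_cast (by omega : 1 < 2 * r - 1)
  have h2 : Tendsto (fun m => (2 * r : ENNReal)⁻¹ * ((2 * r - 1 : ℕ) : ENNReal)⁻¹ ^ m) atTop
      (𝓝 ((2 * r : ENNReal)⁻¹ * 0)) := by
    refine ENNReal.Tendsto.const_mul (ENNReal.tendsto_pow_atTop_nhds_zero_of_lt_one h1)
      (Or.inr (ENNReal.inv_ne_top.2 ?_))
    exact_mod_cast (by omega : 2 * r ≠ 0)
  rw [mul_zero] at h2
  refine le_antisymm (ge_of_tendsto' h2 fun m => ?_) zero_le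
  rw [← boundaryMeasure_cyl hr m ζ]
  exact measure_mono (Set.singleton_subset_iff.2 fun _ _ => rfl)

theorem countable_eventuallyPeriodic : {ξ : Boundary r | EventuallyPeriodic ξ}.Countable := by
  have : {ξ : Boundary r | EventuallyPeriodic ξ} =
      ⋃ p : ℕ, ⋃ (_ : 0 < p), ⋃ N : ℕ, {ξ | ∀ i ≥ N, ξ.1 (i + p) = ξ.1 i} := by
    ext ξ; simp [EventuallyPeriodic]
  rw [this]
  refine Set.countable_iUnion fun p => Set.countable_iUnion fun hp =>
    Set.countable_iUnion fun N => ?_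
  -- such a point is determined by its first `N + p` letters
  have hinj : Set.InjOn (fun (ξ : Boundary r) (i : Fin (N + p)) => ξ.1 i)
      {ξ | ∀ i ≥ N, ξ.1 (i + p) = ξ.1 i} := by
    intro ξ hξ ω hω h
    refine Boundary.ext fun i => ?_
    induction i using Nat.strong_induction_on with
    | _ i ih =>
      rcases lt_or_ge i (N + p) with hi | hi
      · exact congrFun h ⟨i, hi⟩
      · obtain ⟨j, rfl⟩ : ∃ j, i = j + p := ⟨i - p, by omega⟩
        rw [hξ j (by omega), hω j (by omega)]
        exact ih j (by omega)
  exact ((Set.toFinite _).of_finite_image hinj).countable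

theorem ae_not_eventuallyPeriodic (hr : 2 ≤ r) :
    ∀ᵐ ξ ∂boundaryMeasure hr, ¬EventuallyPeriodic ξ := by
  have : NullSingletonClass (boundaryMeasure hr) := ⟨boundaryMeasure_singleton hr⟩
  exact measure_eq_zero_iff_ae_notMem.1 (countable_eventuallyPeriodic.measure_zero _)

theorem preimage_letterAct_cyl_of_eq {s : Letter r} {ζ : Boundary r} (h : ζ.1 0 = s) (m : ℕ) :
    letterAct s ⁻¹' cyl (m + 1) ζ = cyl m (shift ζ) := by
  ext ξ
  by_cases hξ : ξ.1 0 = Letter.inv s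
  · refine iff_of_false (fun h' => ?_) fun h' => ?_
    · have h0 : ξ.1 1 = ζ.1 0 := by
        have := h' 0 (Nat.zero_le _)
        rwa [letterAct, dif_pos hξ] at this
      apply ξ.2 0
      rw [hξ, Letter.inv_inv, zero_add, h0, h]
    · have h0 : ξ.1 0 = ζ.1 1 := h' 0 (Nat.zero_le _)
      apply ζ.2 0
      rw [zero_add, ← h0, hξ, h]
  · rw [Set.mem_preimage, letterAct, dif_neg hξ]
    constructor
    · intro h' i hi
      exact h' (i + 1) (by omega)
    · intro h' i hi
      cases i with
      | zero => exact h.symm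
      | succ i => exact h' i (by omega)

theorem preimage_letterAct_cyl_of_ne {s : Letter r} {ζ : Boundary r} (h : ζ.1 0 ≠ s) (m : ℕ) :
    letterAct s ⁻¹' cyl m ζ =
      cyl (m + 1) (cons (Letter.inv s) ζ (by rwa [Letter.inv_inv])) := by
  ext ξ
  by_cases hξ : ξ.1 0 = Letter.inv s
  · rw [Set.mem_preimage, letterAct, dif_pos hξ]
    constructor
    · intro h' i hi
      cases i with
      | zero => exact hξ
      | succ i => exact h' i (by omega)
    · intro h' i hi
      exact h' (i + 1) (by omega)
  · refine iff_of_false (fun h' => ?_) fun h' => hξ (h' 0 (Nat.zero_le _))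
    have h0 := h' 0 (Nat.zero_le _)
    rw [letterAct, dif_neg hξ] at h0
    exact h h0.symm

/-- Multiplication by a letter `s` changes the Markov measure by the factor `2r - 1` on the words
that begin with `s` and by `(2r - 1)⁻¹` on the others. -/
theorem map_letterAct_boundaryMeasure (hr : 2 ≤ r) (s : Letter r) :
    (boundaryMeasure hr).map (letterAct s) =
      ((2 * r - 1 : ℕ) : ENNReal) • (boundaryMeasure hr).restrict {ξ | ξ.1 0 = s} +
        ((2 * r - 1 : ℕ) : ENNReal)⁻¹ • (boundaryMeasure hr).restrict {ξ | ξ.1 0 = s}ᶜ := by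
  have hc0 : ((2 * r - 1 : ℕ) : ENNReal) ≠ 0 := by exact_mod_cast (by omega : 2 * r - 1 ≠ 0)
  have hct : ((2 * r - 1 : ℕ) : ENNReal) ≠ ⊤ := ENNReal.natCast_ne_top _
  refine Measure.ext_of_generateFrom_of_cover_subset (T := Set.range (cyl (0 + 1)))
    generateFrom_cyl isPiSystem_cyl ?_ (finite_range_cyl _).countable ?_ ?_ ?_
  · rintro _ ⟨ζ, rfl⟩
    exact ⟨0, ζ, rfl⟩
  · exact Set.eq_univ_of_forall fun ξ => ⟨_, ⟨ξ, rfl⟩, fun _ _ => rfl⟩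
  · rintro _ ⟨ζ, rfl⟩
    rw [Measure.map_apply (measurable_letterAct s) (measurableSet_cyl _ _)]
    exact measure_ne_top _ _
  · rintro _ ⟨m, ζ, rfl⟩
    rw [Measure.map_apply (measurable_letterAct s) (measurableSet_cyl _ _), Measure.add_apply,
      Measure.smul_apply, Measure.smul_apply, Measure.restrict_apply (measurableSet_cyl _ _),
      Measure.restrict_apply (measurableSet_cyl _ _)]
    by_cases h : ζ.1 0 = s
    · have h1 : cyl (m + 1) ζ ∩ {ξ | ξ.1 0 = s} = cyl (m + 1) ζ :=
        Set.inter_eq_left.2 fun ξ hξ => (hξ 0 (Nat.zero_le _)).trans h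
      have h2 : cyl (m + 1) ζ ∩ {ξ | ξ.1 0 = s}ᶜ = ∅ :=
        Set.eq_empty_of_forall_notMem fun ξ hξ => hξ.2 ((hξ.1 0 (Nat.zero_le _)).trans h)
      rw [h1, h2, preimage_letterAct_cyl_of_eq h, boundaryMeasure_cyl, boundaryMeasure_cyl,
        measure_empty, smul_zero, add_zero, smul_eq_mul, pow_succ, mul_left_comm, mul_left_comm _ _
          ((2 * r - 1 : ℕ) : ENNReal)⁻¹, ENNReal.mul_inv_cancel hc0 hct, mul_one]
    · have h1 : cyl (m + 1) ζ ∩ {ξ | ξ.1 0 = s} = ∅ :=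
        Set.eq_empty_of_forall_notMem fun ξ hξ =>
          h ((hξ.1 0 (Nat.zero_le _)).symm.trans hξ.2)
      have h2 : cyl (m + 1) ζ ∩ {ξ | ξ.1 0 = s}ᶜ = cyl (m + 1) ζ :=
        Set.inter_eq_left.2 fun ξ hξ hs => h ((hξ 0 (Nat.zero_le _)).symm.trans hs)
      rw [h1, h2, preimage_letterAct_cyl_of_ne h, boundaryMeasure_cyl, boundaryMeasure_cyl,
        measure_empty, smul_zero, zero_add, smul_eq_mul, pow_succ _ (m + 1)]
      ring

theorem quasiMeasurePreserving_letterAct (hr : 2 ≤ r) (s : Letter r) :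
    Measure.QuasiMeasurePreserving (letterAct s) (boundaryMeasure hr) (boundaryMeasure hr) := by
  refine ⟨measurable_letterAct s, ?_⟩
  rw [map_letterAct_boundaryMeasure]
  exact (Measure.smul_absolutelyContinuous.trans Measure.absolutelyContinuous_restrict).add_left
    (Measure.smul_absolutelyContinuous.trans Measure.absolutelyContinuous_restrict)

theorem quasiMeasurePreserving_boundary_smul (hr : 2 ≤ r) (g : F r) :
    Measure.QuasiMeasurePreserving (fun ξ : Boundary r => g • ξ) (boundaryMeasure hr)
      (boundaryMeasure hr) := by
  rw [← FreeGroup.mk_toWord (x := g)]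
  generalize g.toWord = w
  induction w with
  | nil =>
    simp only [← FreeGroup.one_eq_mk, one_smul]
    exact Measure.QuasiMeasurePreserving.id _
  | cons s w ih =>
    simp only [mk_cons_smul]
    exact (quasiMeasurePreserving_letterAct hr s).comp ih

end Measure

/-! ### The diagonal action -/

theorem quasiMeasurePreserving_prodMap {X Y : Type*} [MeasurableSpace X] [MeasurableSpace Y]
    {μ : Measure X} {ν : Measure Y} [SigmaFinite μ] [SigmaFinite ν] {f : X → X} {g : Y → Y}
    (hf : Measure.QuasiMeasurePreserving f μ μ) (hg : Measure.QuasiMeasurePreserving g ν ν) :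
    Measure.QuasiMeasurePreserving (Prod.map f g) (μ.prod ν) (μ.prod ν) := by
  refine ⟨hf.measurable.prodMap hg.measurable, ?_⟩
  have h := Measure.map_prod_map μ ν hf.measurable hg.measurable
  rw [← h]
  exact hf.absolutelyContinuous.prod hg.absolutelyContinuous

/-- The sets `H_ξ ∩ {|g| ≤ 2n}` form an exhaustion by finite subrelations, on a conull set of pairs
`(x, ξ)` whose orbits avoid the eventually periodic points and on which any prescribed property of
full measure holds along orbits. -/
theorem exists_isExhaustion_horoBall {r : ℕ} {X : Type*} [MeasurableSpace X]
    [MulAction (F r) X] {η : Measure (X × Boundary r)} [SigmaFinite η]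
    [MeasurableConstSMul (F r) (X × Boundary r)]
    (hq : ∀ g : F r, Measure.QuasiMeasurePreserving (fun z : X × Boundary r => g • z) η η)
    (hper : ∀ᵐ z ∂η, ¬EventuallyPeriodic z.2) {P : X × Boundary r → Prop} (hP : ∀ᵐ z ∂η, P z) :
    ∃ Z₀ : Set (X × Boundary r),
      IsExhaustion η (fun n (z : X × Boundary r) => (horoBall_finite z.2 n).toFinset) Z₀ ∧
        ∀ z ∈ Z₀, P z := by
  have hmul : ∀ᵐ z ∂η, ∀ g h : F r,
      rnCocycle η (g * h) z = rnCocycle η g z * rnCocycle η h (g⁻¹ • z) := by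
    simp only [ae_all_iff]
    exact rnCocycle_mul hq
  obtain ⟨Z₀, hm, hc, hinv, hZ₀⟩ := exists_invariant_conull hq
    ((hper.and hP).and ((rnCocycle_one (G := F r) η).and hmul))
  refine ⟨Z₀, ?_, fun z hz => (hZ₀ z hz).1.2⟩
  have hballs : ∀ n, ({g : F r | g.norm ≤ 2 * n}).Finite := by
    intro n
    refine Set.Finite.of_finite_image (f := FreeGroup.toWord) ?_ FreeGroup.toWord_injective.injOn
    refine (List.finite_length_le (Letter r) (2 * n)).subset ?_
    rintro _ ⟨g, hg, rfl⟩
    exact hg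
  exact
    { measurableSet_mem := fun n g => by
        simp only [Set.Finite.mem_toFinset]
        exact measurable_snd (measurableSet_mem_horoBall n g)
      mono := fun z m n hmn => Set.Finite.toFinset_subset_toFinset.2 (horoBall_mono z.2 hmn)
      bounded := fun n => ⟨(hballs n).toFinset, fun z =>
        Set.Finite.toFinset_subset_toFinset.2 fun g hg => hg.2⟩
      one_mem := fun n z => (Set.Finite.mem_toFinset _).2 (one_mem_horoBall z.2 n)
      measurableSet := hm
      conull := hc
      smul_mem := hinv
      mem_iff := fun n z hz h hh g => by
        have h1 := (hZ₀ z hz).1.1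
        have h2 : ¬EventuallyPeriodic (h⁻¹ • z.2) := (hZ₀ _ (hinv h⁻¹ z hz)).1.1
        rw [Set.Finite.mem_toFinset, mem_horoBall_iff h1] at hh
        rw [Set.Finite.mem_toFinset, Set.Finite.mem_toFinset, Prod.smul_snd, mem_horoBall_iff h1,
          mem_horoBall_iff h2, mul_inv_rev, mul_smul]
        exact forall₂_congr fun i hi => by rw [hh i hi]
      cocycle_one := fun z hz => (hZ₀ z hz).2.1
      cocycle_mul := fun z hz => (hZ₀ z hz).2.2 }

end HoroRatio

theorem mainTheorem1 (r : ℕ) (hr : 2 ≤ r)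
    (X : Type*) [MeasurableSpace X] [StandardBorelSpace X]
    (μ : Measure X) [SigmaFinite μ] [MulAction (HoroRatio.F r) X]
    (hns : ∀ g : HoroRatio.F r, Measure.QuasiMeasurePreserving (fun x : X => g • x) μ μ)
    (u v : X × HoroRatio.Boundary r → ℝ)
    (hu : Integrable u (μ.prod (HoroRatio.boundaryMeasure hr)))
    (hv : Integrable v (μ.prod (HoroRatio.boundaryMeasure hr)))
    (hvpos : ∀ᵐ z ∂(μ.prod (HoroRatio.boundaryMeasure hr)), 0 < v z) :
    ∃ ρ : X × HoroRatio.Boundary r → ℝ,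
      Measurable ρ ∧
      HoroRatio.RelInvariant (HoroRatio.HoroRel X) ρ ∧
      (∀ᵐ z ∂(μ.prod (HoroRatio.boundaryMeasure hr)),
        Tendsto (fun n : ℕ =>
          HoroRatio.horoSum (μ.prod (HoroRatio.boundaryMeasure hr)) n u z /
            HoroRatio.horoSum (μ.prod (HoroRatio.boundaryMeasure hr)) n v z)
          atTop (𝓝 (ρ z))) ∧
      (HoroRatio.RelErgodic (HoroRatio.HoroRel X) (μ.prod (HoroRatio.boundaryMeasure hr)) →
        ∀ᵐ z ∂(μ.prod (HoroRatio.boundaryMeasure hr)),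
          ρ z = (∫ y, u y ∂(μ.prod (HoroRatio.boundaryMeasure hr))) /
            (∫ y, v y ∂(μ.prod (HoroRatio.boundaryMeasure hr)))) := by
  set η := μ.prod (HoroRatio.boundaryMeasure hr)
  have hq : ∀ g : HoroRatio.F r,
      Measure.QuasiMeasurePreserving (fun z : X × HoroRatio.Boundary r => g • z) η η := fun g =>
    HoroRatio.quasiMeasurePreserving_prodMap (hns g)
      (HoroRatio.quasiMeasurePreserving_boundary_smul hr g)
  have : MeasurableConstSMul (HoroRatio.F r) (X × HoroRatio.Boundary r) :=
    ⟨fun g => (hq g).measurable⟩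
  have hper : ∀ᵐ z ∂η, ¬HoroRatio.EventuallyPeriodic z.2 :=
    Measure.quasiMeasurePreserving_snd.ae (HoroRatio.ae_not_eventuallyPeriodic hr)
  -- replace `u` and `v` by measurable representatives, which agree with them along good orbits
  obtain ⟨u', hum, huu⟩ := hu.aestronglyMeasurable.aemeasurable
  obtain ⟨v', hvm, hvv⟩ := hv.aestronglyMeasurable.aemeasurable
  obtain ⟨Z₀, E, hZ₀⟩ := HoroRatio.exists_isExhaustion_horoBall hq hper
    (P := fun z => u z = u' z ∧ v z = v' z ∧ 0 < v z) (huu.and (hvv.and hvpos))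
  have hrel : HoroRatio.HoroRel X = fun z z' : X × HoroRatio.Boundary r =>
      ∃ n, ∃ h ∈ (HoroRatio.horoBall_finite z.2 n).toFinset, z' = h⁻¹ • z := by
    funext z z'
    simp only [HoroRatio.HoroRel, HoroRatio.mem_horosphere_iff, Set.Finite.mem_toFinset]
    exact propext ⟨fun ⟨g, ⟨n, hg⟩, h⟩ => ⟨n, g, hg, h⟩, fun ⟨n, g, hg, h⟩ => ⟨g, ⟨n, hg⟩, h⟩⟩
  obtain ⟨ρ, hρm, hρinv, hρlim, hρerg⟩ := E.exists_ratio_limit hq hum (hu.congr huu) hvm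
    (hv.congr hvv) fun z hz => by
      obtain ⟨-, h1, h2⟩ := hZ₀ z hz
      rwa [← h1]
  refine ⟨ρ, hρm, ?_, ?_, fun herg => ?_⟩
  · rw [hrel]
    rintro z _ ⟨n, h, hh, rfl⟩
    exact (hρinv z n h hh).symm
  · filter_upwards [hρlim, E.conull] with z hz hz0
    refine hz.congr fun n => ?_
    have hsum : ∀ f f' : X × HoroRatio.Boundary r → ℝ, (∀ z ∈ Z₀, f z = f' z) →
        HoroRatio.horoSum η n f z = HoroRatio.levelSum η
          (fun n (z : X × HoroRatio.Boundary r) => (HoroRatio.horoBall_finite z.2 n).toFinset)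
          n f' z := fun f f' hff => by
      refine Finset.sum_congr rfl fun g _ => ?_
      rw [HoroRatio.That, HoroRatio.That, hff _ (E.smul_mem _ _ hz0)]
    rw [hsum u u' fun z hz => (hZ₀ z hz).1, hsum v v' fun z hz => (hZ₀ z hz).2.1]
  · rw [integral_congr_ae huu, integral_congr_ae hvv]
    exact hρerg (hrel ▸ herg)
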